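/- **Lemma (Early execution).** *Setting.* Consider $N\ge 1$ replicas in an asynchronous network, at most $f=\lceil N/3\rceil-1$ of which are Byzantine, ideal signatures, hashes and nonces, a deterministic service (a state machine on a key-value store), and a pipelining depth $P\ge 1$. In L-PBFT the primary $v \bmod N$ of view $v$ executes a batch of client requests when it proposes it at sequence number $s$: the pre-prepare binds the list $L$ of executed batches before $s$ and the list $G$ of entries $\langle t,i,o\rangle$ (request, index in the execution order, result) of the new batch. A backup executes the batch too; it sends a prepare if its $L$ and $G$ are the same, and undoes the execution otherwise. Pre-prepares are sent and accepted at $s$ only with commitment evidence for the batch at $s-P$. A batch prepares at a replica in view $v$ when the replica has the pre-prepare and $N-f-1$ matching prepares of other replicas and all its batches with lower sequence numbers have prepared; the replica then reveals its nonce (commit message and reply to clients). A batch is *committed* at $(v,s)$ if $N-f$ replicas have signed its pre-prepare or a matching prepare and have revealed their nonces for $(v,s)$. In a view change replicas report the prepared pre-prepares, of largest view, for their last $P$ prepared sequence numbers. From $N-f$ such reports, whose largest sequence number is $n$, the replicas reset their ledger to $n-P$ (batches with commitment evidence), rolling back and, where necessary, fetching and re-executing batches; the batch that prepared with the largest view at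 each of $\max(n-P,0)+1,\dots,n$ is proposed and executed again in the new view. PBFT is the same ordering protocol with pre-prepares that carry no outcome, no execution before commit and no roll-back: a replica executes a committed batch once it has executed all batches with lower sequence numbers. *Claim.* Let a finite run of L-PBFT be given. 1. There is a run of PBFT with the same faulty replicas in which exactly the same messages are sent, up to deleting $(L,G)$ from pre-prepares, and in which, for every $n$ such that a batch is committed at each of $1,\dots,n$ in the L-PBFT run, every correct replica has executed at least $n$ batches. 2. Let a batch be committed at $s$ in the L-PBFT run by a pre-prepare. Then this pre-prepare carries an outcome $(L,G)$, where $L$ consists of $s-1$ batches and $G$ lists the requests of the batch in order, and - in every PBFT run with the same faulty replicas in which (at least) all messages of the L-PBFT run are sent, up to deleting $(L,G)$ from pre-prepares, the sequence of batches executed by any correct replica, with all indices and results, and the sequence $L\,\|\,G$ are comparable: one is a prefix of the other. So early execution and PBFT execution agree on the requests, their order, and their results; - $L\,\|\,G$ is a prefix of the (early) executed ledger of every correct L-PBFT replica that at the end of the run has this pre-prepare in its ledger, or is in a later view and has completed the change to it. So no roll-back loses or changes committed transactions. -/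

import Mathlib

universe u v w

namespace LPBFT

/-! ### The replicated service, and a store whose batches can be rolled back -/

/-- The stored procedures, as a deterministic state machine on the key-value store: running a
request `t` in state `k` gives the next state and the result `o`. -/
structure Service (Tx : Type u) (Res : Type v) (St : Type w) where
  start : St
  run : St → Tx → St × Res

/-- The ledger entries `⟨t, i, o⟩` of one batch, in execution order (the leaves of the tree `G`). -/
abbrev Entry (Tx : Type u) (Res : Type v) := List (Tx × ℕ × Res)

/-- Run a list of requests from state `k`; the first request gets index `i`. -/
def runBatch {Tx : Type u} {Res : Type v} {St : Type w} (svc : Service Tx Res St) :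
    St → ℕ → List Tx → St × Entry Tx Res
  | k, _, [] => (k, [])
  | k, i, t :: ts =>
      ((runBatch svc (svc.run k t).1 (i + 1) ts).1,
        (t, i, (svc.run k t).2) :: (runBatch svc (svc.run k t).1 (i + 1) ts).2)

/-- The key-value store with its roll-back log: for every executed batch, newest first, the
entries it produced and the state that preceded it. -/
structure Store (Tx : Type u) (Res : Type v) (St : Type w) where
  kv : St
  undo : List (Entry Tx Res × St)

namespace Store

variable {Tx : Type u} {Res : Type v} {St : Type w}

/-- The executed batches with their indices and results, oldest first. -/
def ledger (σ : Store Tx Res St) : List (Entry Tx Res) := (σ.undo.map Prod.fst).reverse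

/-- Run a batch in `σ`, whose first request gets the number of executed requests as its index. -/
def result (svc : Service Tx Res St) (σ : Store Tx Res St) (B : List Tx) : St × Entry Tx Res :=
  runBatch svc σ.kv σ.ledger.flatten.length B

/-- Execute a batch and log it for roll-back. -/
def exec (svc : Service Tx Res St) (σ : Store Tx Res St) (B : List Tx) : Store Tx Res St :=
  ⟨(σ.result svc B).1, ((σ.result svc B).2, σ.kv) :: σ.undo⟩

/-- Undo the last executed batch. -/
def undoLast (σ : Store Tx Res St) : Store Tx Res St :=
  match σ.undo with
  | [] => σ
  | (_, k) :: rest => ⟨k, rest⟩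

/-- Undo batches, last one first, until (at most) `n` executed batches are left. -/
def rollback (σ : Store Tx Res St) (n : ℕ) : Store Tx Res St :=
  undoLast^[σ.undo.length - n] σ

end Store

/-! ### Messages -/

/-- A pre-prepare: view, sequence number, batch of requests and, with early execution, the proposed
outcome `(L, G)`: the ledger `L` to which the batch is appended (bound by the root of the
tree `M`) and the entries `G` of the batch (bound by the root of the tree `G`). Hashes are ideal, so
that a hash is represented by what is hashed. -/
structure PrePrepare (Tx : Type u) (Res : Type v) where
  view : ℕ
  seq : ℕ
  batch : List Tx
  early : Option (List (Entry Tx Res) × Entry Tx Res)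

/-- Protocol messages. Signatures are ideal: a message that carries a replica `r` as its first
argument can only be issued by `r`. `commit r v s` is the revealed nonce of `r` for view `v` and
sequence number `s`; it is sent to the replicas and, as a reply, to the clients. In `newView r v V`,
the partial function `V` holds the accepted view-change messages by sender. -/
inductive Msg (N : ℕ) (Tx : Type u) (Res : Type v) : Type (max u v)
  | request (t : Tx)
  | prePrepare (r : Fin N) (pp : PrePrepare Tx Res)
  | prepare (r : Fin N) (pp : PrePrepare Tx Res)
  | commit (r : Fin N) (view seq : ℕ)
  | viewChange (r : Fin N) (view : ℕ) (R : List (PrePrepare Tx Res))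
  | newView (r : Fin N) (view : ℕ) (V : Fin N → Option (List (PrePrepare Tx Res)))

/-- The replica that authenticates a message (none for client requests). -/
def Msg.signer {N : ℕ} {Tx : Type u} {Res : Type v} : Msg N Tx Res → Option (Fin N)
  | .request _ => none
  | .prePrepare r _ => some r
  | .prepare r _ => some r
  | .commit r _ _ => some r
  | .viewChange r _ _ => some r
  | .newView r _ _ => some r

/-- Forget the proposed outcome. -/
def PrePrepare.erase {Tx : Type u} {Res : Type v} (pp : PrePrepare Tx Res) : PrePrepare Tx Res :=
  { pp with early := none }

/-- Forget all proposed outcomes in a message. -/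
def Msg.erase {N : ℕ} {Tx : Type u} {Res : Type v} : Msg N Tx Res → Msg N Tx Res
  | .request t => .request t
  | .prePrepare r pp => .prePrepare r pp.erase
  | .prepare r pp => .prepare r pp.erase
  | .commit r v s => .commit r v s
  | .viewChange r v R => .viewChange r v (R.map PrePrepare.erase)
  | .newView r v V => .newView r v fun q => (V q).map (List.map PrePrepare.erase)

/-! ### Quorums and certificates -/

/-- The number `f = ⌈N / 3⌉ - 1` of tolerated faults. -/
def faults (N : ℕ) : ℕ := ⌈(N : ℚ) / 3⌉₊ - 1

/-- The primary `v mod N` of view `v`. -/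
def primary (N : ℕ) [NeZero N] (v : ℕ) : Fin N := Fin.ofNat N v

section Certificates

variable {N : ℕ} [NeZero N] {Tx : Type u} {Res : Type v}

/-- `r` has signed the pre-prepare: its primary by sending it, a backup by a matching prepare. -/
def Signed (net : Set (Msg N Tx Res)) (r : Fin N) (pp : PrePrepare Tx Res) : Prop :=
  (r = primary N pp.view ∧ Msg.prePrepare r pp ∈ net) ∨
    (r ≠ primary N pp.view ∧ Msg.prepare r pp ∈ net)

/-- The pre-prepare and `N - f - 1` matching prepares of backups. -/
def Prepared (net : Set (Msg N Tx Res)) (pp : PrePrepare Tx Res) : Prop :=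
  ∃ Q : Finset (Fin N), N - faults N ≤ Q.card ∧ primary N pp.view ∈ Q ∧ ∀ r ∈ Q, Signed net r pp

/-- The batch is committed: `N - f` replicas have signed the pre-prepare and have revealed the nonce
that attests that the batch prepared at them in this view. This commitment evidence is
also what a client holds in a receipt for the transactions of the batch. -/
def Committed (net : Set (Msg N Tx Res)) (pp : PrePrepare Tx Res) : Prop :=
  ∃ Q : Finset (Fin N), N - faults N ≤ Q.card ∧
    ∀ r ∈ Q, Signed net r pp ∧ Msg.commit r pp.view pp.seq ∈ net

/-- All requests of the batch have been sent by clients. -/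
def HasRequests (net : Set (Msg N Tx Res)) (B : List Tx) : Prop :=
  ∀ t ∈ B, Msg.request t ∈ net

/-- Commitment evidence for the batch at `s - P` (if there is one) in the ledger `log`. -/
def HasEvidence (P : ℕ) (net : Set (Msg N Tx Res)) (log : List (PrePrepare Tx Res)) (s : ℕ) :
    Prop :=
  ∀ q ∈ log, q.seq + P = s → Committed net q

/-! ### View-change and new-view messages -/

/-- What a correct replica reports in a view change: for each of the last `P` sequence numbers
`n - P + 1, …, n` with a prepared batch, the pre-prepare that prepared with the largest view. -/
def IsReport (P : ℕ) (prepared : Set (PrePrepare Tx Res)) (R : List (PrePrepare Tx Res)) : Prop :=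
  ∃ n, R.map PrePrepare.seq = List.range' (n - P + 1) (min n P) ∧
    (∀ q ∈ prepared, q.seq ≤ n) ∧
    ∀ q ∈ R, q ∈ prepared ∧ ∀ q₁ ∈ prepared, q₁.seq = q.seq → q₁.view ≤ q.view

/-- The check of a received view-change message for view `v`. -/
def ValidReport (P : ℕ) (net : Set (Msg N Tx Res)) (v : ℕ) (R : List (PrePrepare Tx Res)) : Prop :=
  (∃ n, R.map PrePrepare.seq = List.range' (n - P + 1) (min n P)) ∧
    ∀ q ∈ R, q.view < v ∧ Prepared net q

/-- The view-change messages `V` are genuine, valid, and come from at least `N - f` replicas. -/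
def ValidViewChanges (P : ℕ) (net : Set (Msg N Tx Res)) (v : ℕ)
    (V : Fin N → Option (List (PrePrepare Tx Res))) : Prop :=
  N - faults N ≤ (Finset.univ.filter fun r => (V r).isSome = true).card ∧
    ∀ r R, V r = some R → Msg.viewChange r v R ∈ net ∧ ValidReport P net v R

/-- `q` is reported in `V`. -/
def Reported (V : Fin N → Option (List (PrePrepare Tx Res))) (q : PrePrepare Tx Res) : Prop :=
  ∃ r R, V r = some R ∧ q ∈ R

/-- `n` is the last sequence number with a prepared batch in `V`, and `0` if there is none. -/
def IsLast (V : Fin N → Option (List (PrePrepare Tx Res))) (n : ℕ) : Prop :=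
  (∀ q, Reported V q → q.seq ≤ n) ∧ (n = 0 ∨ ∃ q, Reported V q ∧ q.seq = n)

/-- `q` is reported in `V` and prepared with the largest view for its sequence number. -/
def IsPick (V : Fin N → Option (List (PrePrepare Tx Res))) (q : PrePrepare Tx Res) : Prop :=
  Reported V q ∧ ∀ q₁, Reported V q₁ → q₁.seq = q.seq → q₁.view ≤ q.view

end Certificates

/-! ### Replicas -/

/-- The two execution disciplines: early execution, with results in the pre-prepare and roll-back,
and execution after commit. The ordering of batches is the same. -/
inductive Mode
  | lpbft
  | pbft

/-- Local state of a replica. `log` is the sequence of pre-prepared batches in the ledger (the batch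
with sequence number `s` at position `s - 1`); `prepared` contains the pre-prepares (of all
views) that prepared locally or were fetched with commitment evidence. -/
structure Replica (Tx : Type u) (Res : Type v) (St : Type w) where
  view : ℕ
  ready : Bool
  log : List (PrePrepare Tx Res)
  prepared : Set (PrePrepare Tx Res)
  store : Store Tx Res St

section Protocol

variable {N : ℕ} [NeZero N] {Tx : Type u} {Res : Type v} {St : Type w}

/-- Processing of a pre-prepare in the store. With early execution the batch is executed, and
the ledger and the entries have to be those in the pre-prepare; without, nothing is executed. -/
def PreExec (svc : Service Tx Res St) (m : Mode) (σ : Store Tx Res St) (pp : PrePrepare Tx Res)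
    (σ₁ : Store Tx Res St) : Prop :=
  match m with
  | .lpbft => pp.early = some (σ.ledger, (σ.result svc pp.batch).2) ∧ σ₁ = σ.exec svc pp.batch
  | .pbft => pp.early = none ∧ σ₁ = σ

/-- `PreExec` for a list of pre-prepares, in order. -/
def PreExecAll (svc : Service Tx Res St) (m : Mode) :
    Store Tx Res St → List (PrePrepare Tx Res) → Store Tx Res St → Prop
  | σ, [], σ₁ => σ₁ = σ
  | σ, pp :: W, σ₁ => ∃ τ, PreExec svc m σ pp τ ∧ PreExecAll svc m τ W σ₁

/-- Resetting the ledger to `L`. With early execution some suffix of the executed batches is rolled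
back and missing batches are fetched and executed, so that the store has exactly
the entries in `L`; without, only committed batches were executed and there is nothing to undo. -/
def Reset (svc : Service Tx Res St) (m : Mode) (σ : Store Tx Res St) (L : List (PrePrepare Tx Res))
    (σ₁ : Store Tx Res St) : Prop :=
  match m with
  | .lpbft => (∃ (k : ℕ) (Bs : List (List Tx)), σ₁ = Bs.foldl (Store.exec svc) (σ.rollback k)) ∧
      L.map (fun q => q.early.map Prod.snd) = σ₁.ledger.map some
  | .pbft => σ₁ = σ

/-- The replica `a` enters view `v` with the view-change messages `V` and the new pre-prepares `W`
and becomes `b`: with `n` the last reported sequence number, it resets its ledger to `n - P`,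
up to which all batches have commitment evidence, and then processes pre-prepares in view `v`
of the batches that were picked for `n - P + 1, …, n`. -/
def EnterView (svc : Service Tx Res St) (P : ℕ) (m : Mode) (net : Set (Msg N Tx Res)) (v : ℕ)
    (V : Fin N → Option (List (PrePrepare Tx Res))) (W : List (PrePrepare Tx Res))
    (a b : Replica Tx Res St) : Prop :=
  ∃ (n : ℕ) (L : List (PrePrepare Tx Res)) (σ τ : Store Tx Res St),
    ValidViewChanges P net v V ∧ IsLast V n ∧
    L.map PrePrepare.seq = List.range' 1 (n - P) ∧
    (∀ q ∈ L, q.view < v ∧ Committed net q) ∧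
    Reset svc m a.store L σ ∧
    W.map PrePrepare.seq = List.range' (n - P + 1) (min n P) ∧
    (∀ q ∈ W, q.view = v ∧ HasRequests net q.batch ∧
      ∃ q₁, IsPick V q₁ ∧ q₁.seq = q.seq ∧ q₁.batch = q.batch) ∧
    PreExecAll svc m σ W τ ∧
    b = { view := v, ready := true, log := L ++ W, prepared := a.prepared ∪ {q | q ∈ L}, store := τ }

/-- A global configuration: all messages sent so far (the network is asynchronous: a sent message may
be received at any later time, in any order, or never) and the states of the replicas. The
states of faulty replicas are irrelevant. -/
structure Config (N : ℕ) (Tx : Type u) (Res : Type v) (St : Type w) where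
  net : Set (Msg N Tx Res)
  rep : Fin N → Replica Tx Res St

/-- Replica `r` moves to state `b` and sends the messages `out`. -/
def Config.set (c : Config N Tx Res St) (r : Fin N) (b : Replica Tx Res St)
    (out : Set (Msg N Tx Res)) : Config N Tx Res St :=
  ⟨c.net ∪ out, Function.update c.rep r b⟩

/-- The initial configuration. -/
def Config.start (N : ℕ) {Tx : Type u} {Res : Type v} {St : Type w} (svc : Service Tx Res St) :
    Config N Tx Res St :=
  ⟨∅, fun _ => ⟨0, true, [], ∅, ⟨svc.start, []⟩⟩⟩

/-- One step of the protocol with pipelining depth `P` and faulty replicas `byz`. -/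
inductive Step (svc : Service Tx Res St) (P : ℕ) (m : Mode) (byz : Finset (Fin N)) :
    Config N Tx Res St → Config N Tx Res St → Prop
  /-- A client sends a request. -/
  | request (c : Config N Tx Res St) (t : Tx) :
      Step svc P m byz c ⟨c.net ∪ {Msg.request t}, c.rep⟩
  /-- A faulty replica sends any message that it can authenticate. -/
  | faulty (c : Config N Tx Res St) (r : Fin N) (x : Msg N Tx Res) (hr : r ∈ byz)
      (hx : x.signer = some r) : Step svc P m byz c ⟨c.net ∪ {x}, c.rep⟩
  /-- The primary sends a pre-prepare (with early execution: executes the batch first). -/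
  | sendPrePrepare (c : Config N Tx Res St) (r : Fin N) (pp : PrePrepare Tx Res)
      (σ : Store Tx Res St) (hr : r ∉ byz) (hready : (c.rep r).ready = true)
      (hprimary : r = primary N (c.rep r).view) (hview : pp.view = (c.rep r).view)
      (hseq : pp.seq = (c.rep r).log.length + 1) (hne : pp.batch ≠ [])
      (hreq : HasRequests c.net pp.batch) (hev : HasEvidence P c.net (c.rep r).log pp.seq)
      (hexec : PreExec svc m (c.rep r).store pp σ) :
      Step svc P m byz c (c.set r
        { c.rep r with log := (c.rep r).log ++ [pp], store := σ } {Msg.prePrepare r pp})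
  /-- A backup accepts the next pre-prepare of its view (with early execution: executes the batch
  and finds its ledger and results equal to those in the pre-prepare) and sends a prepare. -/
  | acceptPrePrepare (c : Config N Tx Res St) (r : Fin N) (pp : PrePrepare Tx Res)
      (σ : Store Tx Res St) (hr : r ∉ byz) (hready : (c.rep r).ready = true)
      (hbackup : r ≠ primary N (c.rep r).view) (hview : pp.view = (c.rep r).view)
      (hseq : pp.seq = (c.rep r).log.length + 1)
      (hpp : Msg.prePrepare (primary N pp.view) pp ∈ c.net)
      (hreq : HasRequests c.net pp.batch) (hev : HasEvidence P c.net (c.rep r).log pp.seq)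
      (hexec : PreExec svc m (c.rep r).store pp σ) :
      Step svc P m byz c (c.set r
        { c.rep r with log := (c.rep r).log ++ [pp], store := σ } {Msg.prepare r pp})
  /-- Early execution: a backup executes the batch of a pre-prepare, finds a mismatch, and undoes the
  execution. -/
  | rejectPrePrepare (c : Config N Tx Res St) (r : Fin N) (pp : PrePrepare Tx Res)
      (hm : m = Mode.lpbft) (hr : r ∉ byz) (hready : (c.rep r).ready = true)
      (hbackup : r ≠ primary N (c.rep r).view) (hview : pp.view = (c.rep r).view)
      (hseq : pp.seq = (c.rep r).log.length + 1)
      (hpp : Msg.prePrepare (primary N pp.view) pp ∈ c.net)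
      (hexec : ¬ ∃ σ, PreExec svc m (c.rep r).store pp σ) :
      Step svc P m byz c (c.set r
        { c.rep r with store := ((c.rep r).store.exec svc pp.batch).undoLast } ∅)
  /-- A batch prepares at a replica in its current view, all batches with lower sequence numbers
  having prepared; the replica reveals its nonce (commit and reply). -/
  | batchPrepared (c : Config N Tx Res St) (r : Fin N) (pp : PrePrepare Tx Res) (hr : r ∉ byz)
      (hready : (c.rep r).ready = true) (hview : pp.view = (c.rep r).view)
      (hlog : pp ∈ (c.rep r).log) (hprep : Prepared c.net pp)
      (hlow : ∀ q ∈ (c.rep r).log, q.seq < pp.seq → q ∈ (c.rep r).prepared) :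
      Step svc P m byz c (c.set r
        { c.rep r with prepared := (c.rep r).prepared ∪ {pp} } {Msg.commit r pp.view pp.seq})
  /-- Execution after commit: a replica executes a committed batch once it has executed
  all batches with lower sequence numbers. -/
  | execCommitted (c : Config N Tx Res St) (r : Fin N) (pp : PrePrepare Tx Res)
      (hm : m = Mode.pbft) (hr : r ∉ byz) (hcom : Committed c.net pp)
      (hseq : pp.seq = (c.rep r).store.ledger.length + 1) :
      Step svc P m byz c (c.set r
        { c.rep r with store := (c.rep r).store.exec svc pp.batch } ∅)
  /-- A replica suspects the primary (at any time) or joins more than `f` others in a view change. -/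
  | sendViewChange (c : Config N Tx Res St) (r : Fin N) (v : ℕ) (R : List (PrePrepare Tx Res))
      (hr : r ∉ byz)
      (hv : v = (c.rep r).view + 1 ∨ ((c.rep r).view < v ∧ ∃ Q : Finset (Fin N),
        faults N < Q.card ∧ ∀ q ∈ Q, ∃ R₁, Msg.viewChange q v R₁ ∈ c.net ∧
          ValidReport P c.net v R₁))
      (hR : IsReport P (c.rep r).prepared R) :
      Step svc P m byz c (c.set r
        { c.rep r with view := v, ready := false } {Msg.viewChange r v R})
  /-- The primary of a new view sends the new-view message and resends the picked batches. -/
  | sendNewView (c : Config N Tx Res St) (r : Fin N)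
      (V : Fin N → Option (List (PrePrepare Tx Res))) (W : List (PrePrepare Tx Res))
      (b : Replica Tx Res St) (hr : r ∉ byz) (hready : (c.rep r).ready = false)
      (hprimary : r = primary N (c.rep r).view)
      (henter : EnterView svc P m c.net (c.rep r).view V W (c.rep r) b) :
      Step svc P m byz c (c.set r b
        ({Msg.newView r (c.rep r).view V} ∪ {x | ∃ pp ∈ W, x = Msg.prePrepare r pp}))
  /-- A backup accepts a new-view message with its pre-prepares. -/
  | acceptNewView (c : Config N Tx Res St) (r : Fin N)
      (V : Fin N → Option (List (PrePrepare Tx Res))) (W : List (PrePrepare Tx Res))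
      (b : Replica Tx Res St) (hr : r ∉ byz) (hready : (c.rep r).ready = false)
      (hbackup : r ≠ primary N (c.rep r).view)
      (hnv : Msg.newView (primary N (c.rep r).view) (c.rep r).view V ∈ c.net)
      (hW : ∀ pp ∈ W, Msg.prePrepare (primary N (c.rep r).view) pp ∈ c.net)
      (henter : EnterView svc P m c.net (c.rep r).view V W (c.rep r) b) :
      Step svc P m byz c (c.set r b {x | ∃ pp ∈ W, x = Msg.prepare r pp})

/-- The configuration occurs in some run of the protocol. -/
def Reachable (svc : Service Tx Res St) (P : ℕ) (m : Mode) (byz : Finset (Fin N))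
    (c : Config N Tx Res St) : Prop :=
  Relation.ReflTransGen (Step svc P m byz) (Config.start N svc) c

end Protocol

end LPBFT

namespace LPBFT

/-! ### Deterministic execution, roll-back and recorded outcomes. -/

section StoreLemmas

variable {Tx : Type u} {Res : Type v} {St : Type w} (svc : Service Tx Res St)

/-! Ordering. `ReplicaInv` records where the ledger of a correct replica comes from: a part with
commitment evidence from earlier views, followed by entries signed in the view of the ledger, the
first of which were picked from view-change reports. Two quorums of size `N - f` share a correct
replica. Strong induction on views then gives `Inv.persists`: a correct replica common to the commit
quorum and the view-change quorum forces the new view to keep the committed batch, because its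
report makes the pick at that position at least as recent as the commit. Agreement on committed
batches (`Inv.batch_eq`) follows, in both modes.

Execution. By determinism a list of batches determines the executed ledger, and the ledger
determines the list, since entries contain their requests. The `L` bound by a pre-prepare therefore
fixes the whole history before it. In `Inv.exists_outcome` the correct members of a commit quorum
all executed the same batches before the committed one, and each of these either has commitment
evidence or was prepared by all of these members in the same view. Faulty members need not have
revealed nonces for those predecessors, so the history is only known to be `WeaklyCommitted`. This
notion looks at correct members only; it is enough for the quorum arguments and is preserved when
outcomes are erased.

Conclusion. Erasing outcomes and postponing all executions turns an L-PBFT run into a PBFT run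
(`Reachable.erase`), at whose end the committed batches can be executed. In any PBFT run that
contains the erased messages, the batches behind `L ++ [G]` are weakly committed, so agreement
inside that run makes the ledgers comparable (`ledger_comparable`). As for roll-back, a ledger of a
later view contains the history by persistence (`Inv.isPrefix_log`), and a ledger of the same view
that contains the pre-prepare has that history because `L` fixes it. -/

theorem runBatch_map_fst (k : St) (i : ℕ) (B : List Tx) :
    (runBatch svc k i B).2.map Prod.fst = B := by
  induction B generalizing k i with
  | nil => rfl
  | cons t ts ih => simp [runBatch, ih]

namespace Store

theorem undoLast_exec (σ : Store Tx Res St) (B : List Tx) : (σ.exec svc B).undoLast = σ := rfl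

theorem ledger_exec (σ : Store Tx Res St) (B : List Tx) :
    (σ.exec svc B).ledger = σ.ledger ++ [(σ.result svc B).2] := by
  simp [ledger, exec]

theorem result_map_fst (σ : Store Tx Res St) (B : List Tx) :
    (σ.result svc B).2.map Prod.fst = B := runBatch_map_fst svc _ _ B

end Store

/-- The store after executing the batches `Bs` from the start. -/
def execAll (Bs : List (List Tx)) : Store Tx Res St := Bs.foldl (Store.exec svc) ⟨svc.start, []⟩

/-- The ledger before, and the entries of, the batch `B` when it is executed after `Bs`. -/
def outcome (Bs : List (List Tx)) (B : List Tx) : List (Entry Tx Res) × Entry Tx Res :=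
  ((execAll svc Bs).ledger, ((execAll svc Bs).result svc B).2)

theorem execAll_append (Bs Cs : List (List Tx)) :
    execAll svc (Bs ++ Cs) = Cs.foldl (Store.exec svc) (execAll svc Bs) := by
  simp [execAll]

theorem execAll_concat (Bs : List (List Tx)) (B : List Tx) :
    execAll svc (Bs ++ [B]) = (execAll svc Bs).exec svc B := by
  simp [execAll]

theorem execAll_concat_ledger (Bs : List (List Tx)) (B : List Tx) :
    (execAll svc (Bs ++ [B])).ledger = (outcome svc Bs B).1 ++ [(outcome svc Bs B).2] := by
  rw [execAll_concat, Store.ledger_exec]; rfl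

theorem execAll_ledger_requests (Bs : List (List Tx)) :
    (execAll svc Bs).ledger.map (List.map Prod.fst) = Bs := by
  induction Bs using List.reverseRecOn with
  | nil => rfl
  | append_singleton Bs B ih =>
    rw [execAll_concat, Store.ledger_exec, List.map_append, ih]
    simp [Store.result_map_fst]

theorem execAll_ledger_length (Bs : List (List Tx)) :
    (execAll svc Bs).ledger.length = Bs.length := by
  conv_rhs => rw [← execAll_ledger_requests svc Bs, List.length_map]

/-- Entries contain their requests, so a ledger reveals which batches produced it. This is what
makes `L` in a pre-prepare a commitment to the whole history. -/
theorem execAll_ledger_injective {Bs Cs : List (List Tx)}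
    (h : (execAll svc Bs).ledger = (execAll svc Cs).ledger) : Bs = Cs := by
  rw [← execAll_ledger_requests svc Bs, h, execAll_ledger_requests]

theorem execAll_ledger_prefix {Bs Cs : List (List Tx)} (h : Bs <+: Cs) :
    (execAll svc Bs).ledger <+: (execAll svc Cs).ledger := by
  obtain ⟨Ds, rfl⟩ := h
  induction Ds using List.reverseRecOn with
  | nil => simp
  | append_singleton Ds D ih =>
    rw [← List.append_assoc, execAll_concat, Store.ledger_exec]
    exact ih.trans (List.prefix_append _ _)

/-- Each executed batch logs the state before it, so an undo gives back exactly the previous store;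
on an empty log it does nothing. -/
theorem rollback_execAll (Bs : List (List Tx)) (k : ℕ) :
    ∃ Cs, (execAll svc Bs).rollback k = execAll svc Cs := by
  unfold Store.rollback
  generalize (execAll svc Bs).undo.length - k = j
  induction j generalizing Bs with
  | zero => exact ⟨Bs, rfl⟩
  | succ j ih =>
    rw [Function.iterate_succ_apply]
    rcases List.eq_nil_or_concat Bs with rfl | ⟨Bs, B, rfl⟩
    · exact ih []
    · rw [List.concat_eq_append, execAll_concat, Store.undoLast_exec]
      exact ih Bs

theorem preExec_execAll {Bs : List (List Tx)} {pp : PrePrepare Tx Res} {σ : Store Tx Res St}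
    (h : PreExec svc Mode.lpbft (execAll svc Bs) pp σ) :
    pp.early = some (outcome svc Bs pp.batch) ∧ σ = execAll svc (Bs ++ [pp.batch]) :=
  ⟨h.1, h.2.trans (execAll_concat svc Bs pp.batch).symm⟩

theorem preExecAll_execAll {Bs : List (List Tx)} {W : List (PrePrepare Tx Res)}
    {σ : Store Tx Res St} (h : PreExecAll svc Mode.lpbft (execAll svc Bs) W σ) :
    σ = execAll svc (Bs ++ W.map PrePrepare.batch) ∧ ∀ i q, W[i]? = some q →
      q.early = some (outcome svc (Bs ++ (W.take i).map PrePrepare.batch) q.batch) := by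
  induction W generalizing Bs with
  | nil => exact ⟨by simpa [PreExecAll] using h, by simp⟩
  | cons pp W ih =>
    obtain ⟨τ, h₁, h₂⟩ := h
    obtain ⟨he, rfl⟩ := preExec_execAll svc h₁
    obtain ⟨h₃, h₄⟩ := ih h₂
    refine ⟨by simpa using h₃, fun i q hq => ?_⟩
    cases i with
    | zero => simp at hq; subst hq; simpa using he
    | succ i => simpa using h₄ i q (by simpa using hq)

end StoreLemmas

/-! ### Quorum intersection. -/

section Quorums

/-- The intersection has at least `N - 2f > f` members, too many to be all faulty. -/
theorem quorum_inter_of_three_mul_lt {N f : ℕ} (hf : 3 * f < N) {byz Q₁ Q₂ : Finset (Fin N)}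
    (hbyz : byz.card ≤ f) (h₁ : N - f ≤ Q₁.card) (h₂ : N - f ≤ Q₂.card) :
    ∃ r, r ∉ byz ∧ r ∈ Q₁ ∧ r ∈ Q₂ := by
  by_contra! h
  have hsub : Q₁ ∩ Q₂ ⊆ byz := fun r hr => by
    by_contra hb
    exact h r hb (Finset.mem_inter.1 hr).1 (Finset.mem_inter.1 hr).2
  have h₃ := Finset.card_le_card hsub
  have h₄ := Finset.card_union_add_card_inter Q₁ Q₂
  have h₅ : (Q₁ ∪ Q₂).card ≤ N := (Finset.card_le_univ _).trans (by simp)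
  omega

variable {N : ℕ} [NeZero N]

theorem three_mul_faults_lt : 3 * faults N < N := by
  have hN : 0 < N := Nat.pos_of_ne_zero (NeZero.ne N)
  have h : (⌈(N : ℚ) / 3⌉₊ : ℚ) < N / 3 + 1 := Nat.ceil_lt_add_one (by positivity)
  have h' : 3 * ⌈(N : ℚ) / 3⌉₊ < N + 3 := by
    have : (3 * ⌈(N : ℚ) / 3⌉₊ : ℚ) < N + 3 := by linarith
    exact_mod_cast this
  unfold faults
  omega

theorem exists_correct_mem_inter {byz Q₁ Q₂ : Finset (Fin N)} (hbyz : byz.card ≤ faults N)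
    (h₁ : N - faults N ≤ Q₁.card) (h₂ : N - faults N ≤ Q₂.card) :
    ∃ r, r ∉ byz ∧ r ∈ Q₁ ∧ r ∈ Q₂ :=
  quorum_inter_of_three_mul_lt three_mul_faults_lt hbyz h₁ h₂

theorem exists_correct_mem {byz Q : Finset (Fin N)} (hbyz : byz.card ≤ faults N)
    (h : N - faults N ≤ Q.card) : ∃ r, r ∉ byz ∧ r ∈ Q :=
  (exists_correct_mem_inter hbyz h h).imp fun _ hr => ⟨hr.1, hr.2.1⟩

end Quorums

/-! ### Certificates remain valid as messages accumulate. -/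

section Monotone

variable {N : ℕ} {Tx : Type u} {Res : Type v} {net net' : Set (Msg N Tx Res)}

/-- `r` has sent the pre-prepare or a matching prepare. -/
def Sent (net : Set (Msg N Tx Res)) (r : Fin N) (pp : PrePrepare Tx Res) : Prop :=
  Msg.prePrepare r pp ∈ net ∨ Msg.prepare r pp ∈ net

theorem Sent.mono (h : net ⊆ net') {r : Fin N} {pp : PrePrepare Tx Res} (hs : Sent net r pp) :
    Sent net' r pp := hs.imp (@h _) (@h _)

variable [NeZero N]

theorem Signed.sent {r : Fin N} {pp : PrePrepare Tx Res} (h : Signed net r pp) : Sent net r pp :=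
  h.imp And.right And.right

theorem Signed.mono (h : net ⊆ net') {r : Fin N} {pp : PrePrepare Tx Res}
    (hs : Signed net r pp) : Signed net' r pp :=
  hs.imp (And.imp_right (@h _)) (And.imp_right (@h _))

theorem Prepared.mono (h : net ⊆ net') {pp : PrePrepare Tx Res} (hs : Prepared net pp) :
    Prepared net' pp := by
  obtain ⟨Q, h₁, h₂, h₃⟩ := hs
  exact ⟨Q, h₁, h₂, fun r hr => (h₃ r hr).mono h⟩

theorem Committed.mono (h : net ⊆ net') {pp : PrePrepare Tx Res} (hs : Committed net pp) :
    Committed net' pp := by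
  obtain ⟨Q, h₁, h₃⟩ := hs
  exact ⟨Q, h₁, fun r hr => ⟨(h₃ r hr).1.mono h, h (h₃ r hr).2⟩⟩

theorem ValidViewChanges.mono (h : net ⊆ net') {P v : ℕ}
    {V : Fin N → Option (List (PrePrepare Tx Res))} (hV : ValidViewChanges P net v V) :
    ValidViewChanges P net' v V :=
  ⟨hV.1, fun r R hR => ⟨h (hV.2 r R hR).1, (hV.2 r R hR).2.1,
    fun q hq => ⟨((hV.2 r R hR).2.2 q hq).1, ((hV.2 r R hR).2.2 q hq).2.mono h⟩⟩⟩

end Monotone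

/-! ### The invariant of a correct replica and its preservation by local changes. -/

section Invariant

variable {N : ℕ} [NeZero N] {Tx : Type u} {Res : Type v} {St : Type w}
  (svc : Service Tx Res St) (P : ℕ) (m : Mode)

/-- How a correct replica `r` came to have the ledger `log` in view `v`: it entered the view with `n`
batches, of which all but the last `P` have commitment evidence and the others were
picked, and it has signed the batches from `n - P + 1` on in view `v`. -/
def LogOK (net : Set (Msg N Tx Res)) (r : Fin N) (v : ℕ) (log : List (PrePrepare Tx Res)) : Prop :=
  ∃ n, n ≤ log.length ∧
    ((v = 0 ∧ n = 0) ∨ ∃ V, ValidViewChanges P net v V ∧ IsLast V n ∧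
      ∀ q ∈ log, n - P < q.seq → q.seq ≤ n →
        ∃ q₁, IsPick V q₁ ∧ q₁.seq = q.seq ∧ q₁.batch = q.batch) ∧
    ∀ i q, log[i]? = some q → q.seq = i + 1 ∧
      ((q.seq ≤ n - P ∧ q.view < v ∧ Committed net q) ∨
        (n - P < q.seq ∧ q.view = v ∧ Sent net r q ∧ (m = Mode.lpbft →
          q.early = some (outcome svc ((log.take i).map PrePrepare.batch) q.batch))))

/-- What holds when a correct replica `r` has revealed its nonce for view `v` and sequence number
`s`. -/
def CommitOK (net : Set (Msg N Tx Res)) (r : Fin N) (prepared : Set (PrePrepare Tx Res))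
    (v s : ℕ) : Prop :=
  ∃ log pp, LogOK svc P m net r v log ∧ pp ∈ log ∧ pp.view = v ∧ pp.seq = s ∧ Prepared net pp ∧
    pp ∈ prepared ∧ ∀ q ∈ log, q.seq < s →
      Committed net q ∨ (Prepared net q ∧ Msg.commit r q.view q.seq ∈ net)

/-- What holds when a correct replica `r` has sent a view-change message. -/
def ReportOK (net : Set (Msg N Tx Res)) (r : Fin N) (v : ℕ) (R : List (PrePrepare Tx Res)) : Prop :=
  ∃ n, R.map PrePrepare.seq = List.range' (n - P + 1) (min n P) ∧
    ∀ v₁ s, Msg.commit r v₁ s ∈ net → v₁ < v →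
      s ≤ n ∧ ∀ q ∈ R, q.seq = s → v₁ ≤ q.view

/-- The invariant of a correct replica `r` in state `a`, whose ledger belongs to view `lv`. -/
structure ReplicaInvAt (net : Set (Msg N Tx Res)) (r : Fin N) (a : Replica Tx Res St) (lv : ℕ) :
    Prop where
  log_view : (a.ready = true ∧ lv = a.view) ∨ (a.ready = false ∧ lv < a.view)
  log_ok : LogOK svc P m net r lv a.log
  sent : ∀ pp, Sent net r pp → pp.view ≤ lv ∧ (pp.view = lv → pp ∈ a.log) ∧
    ∃ log, LogOK svc P m net r pp.view log ∧ pp ∈ log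
  sent_unique : ∀ pp pp₁, Sent net r pp → Sent net r pp₁ → pp.view = pp₁.view →
    pp.seq = pp₁.seq → pp = pp₁
  commit : ∀ v s, Msg.commit r v s ∈ net → v ≤ lv ∧ CommitOK svc P m net r a.prepared v s
  prepared : ∀ q ∈ a.prepared,
    Committed net q ∨ (Prepared net q ∧ Msg.commit r q.view q.seq ∈ net)
  viewChange : ∀ v R, Msg.viewChange r v R ∈ net → v ≤ a.view ∧ ReportOK P net r v R
  store : m = Mode.lpbft → a.store = execAll svc (a.log.map PrePrepare.batch)

/-- The invariant of a correct replica. -/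
def ReplicaInv (net : Set (Msg N Tx Res)) (r : Fin N) (a : Replica Tx Res St) : Prop :=
  ∃ lv, ReplicaInvAt svc P m net r a lv

variable {svc P m} {net net' : Set (Msg N Tx Res)} {r : Fin N} {a b : Replica Tx Res St}

theorem LogOK.mono (h : net ⊆ net') {v : ℕ} {log : List (PrePrepare Tx Res)}
    (hl : LogOK svc P m net r v log) : LogOK svc P m net' r v log := by
  obtain ⟨n, h₁, h₂, h₃⟩ := hl
  refine ⟨n, h₁, h₂.imp_right fun ⟨V, hV, h⟩ => ⟨V, hV.mono ‹_›, h⟩, fun i q hq => ?_⟩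
  refine ⟨(h₃ i q hq).1, (h₃ i q hq).2.imp (fun h' => ⟨h'.1, h'.2.1, h'.2.2.mono h⟩)
    fun h' => ⟨h'.1, h'.2.1, h'.2.2.1.mono h, h'.2.2.2⟩⟩

theorem LogOK.eq_of_seq_eq {v : ℕ} {log : List (PrePrepare Tx Res)}
    (hl : LogOK svc P m net r v log) {q q₁ : PrePrepare Tx Res} (hq : q ∈ log) (hq₁ : q₁ ∈ log)
    (h : q.seq = q₁.seq) : q = q₁ := by
  obtain ⟨n, -, -, h₃⟩ := hl
  obtain ⟨i, hi⟩ := List.mem_iff_getElem?.1 hq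
  obtain ⟨j, hj⟩ := List.mem_iff_getElem?.1 hq₁
  have h₁ := (h₃ i q hi).1
  have h₂ := (h₃ j q₁ hj).1
  obtain rfl : i = j := by omega
  exact Option.some.inj (hi.symm.trans hj)

theorem CommitOK.mono (h : net ⊆ net') {S S' : Set (PrePrepare Tx Res)} (hS : S ⊆ S') {v s : ℕ}
    (hc : CommitOK svc P m net r S v s) : CommitOK svc P m net' r S' v s := by
  obtain ⟨log, pp, h₁, h₂, h₃, h₄, h₅, h₆, h₇⟩ := hc
  exact ⟨log, pp, h₁.mono h, h₂, h₃, h₄, h₅.mono h, hS h₆, fun q hq hs =>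
    (h₇ q hq hs).imp (fun h' => h'.mono h) fun h' => ⟨h'.1.mono h, h h'.2⟩⟩

/-- Messages that `r` does not sign do not affect its invariant. -/
theorem ReplicaInv.mono (h : net ⊆ net') (hnew : ∀ x ∈ net', x.signer = some r → x ∈ net)
    (ha : ReplicaInv svc P m net r a) : ReplicaInv svc P m net' r a := by
  obtain ⟨lv, ha⟩ := ha
  have hs : ∀ pp, Sent net' r pp → Sent net r pp := fun pp hp =>
    hp.imp (fun h => hnew _ h rfl) fun h => hnew _ h rfl
  refine ⟨lv, ha.log_view, ha.log_ok.mono h, fun pp hp => ?_, fun pp pp₁ hp hp₁ => ?_,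
    fun v s hc => ?_, fun q hq => ?_, fun v R hv => ?_, ha.store⟩
  · obtain ⟨h₁, h₂, log, h₃, h₄⟩ := ha.sent pp (hs pp hp)
    exact ⟨h₁, h₂, log, h₃.mono h, h₄⟩
  · exact ha.sent_unique pp pp₁ (hs _ hp) (hs _ hp₁)
  · have := ha.commit v s (hnew _ hc rfl)
    exact ⟨this.1, this.2.mono h subset_rfl⟩
  · exact (ha.prepared q hq).imp (fun h' => h'.mono h) fun h' => ⟨h'.1.mono h, h h'.2⟩
  · obtain ⟨h₁, n, h₂, h₃⟩ := ha.viewChange v R (hnew _ hv rfl)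
    exact ⟨h₁, n, h₂, fun v₁ s hc => h₃ v₁ s (hnew _ hc rfl)⟩

/-- The invariant is preserved when `r` extends its ledger, or enters a view, and signs batches of
the new ledger in its current view. -/
theorem ReplicaInv.updateLog (ha : ReplicaInv svc P m net r a) (h : net ⊆ net')
    (hnew : ∀ x ∈ net', x.signer = some r → x ∈ net ∨ (∃ v V, x = Msg.newView r v V) ∨
      ∃ pp ∈ b.log, pp.view = b.view ∧ (x = Msg.prePrepare r pp ∨ x = Msg.prepare r pp))
    (hready : b.ready = true) (hview : b.view = a.view)
    (hlog : a.ready = true → ∀ q ∈ a.log, q ∈ b.log) (hok : LogOK svc P m net' r b.view b.log)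
    (hsub : a.prepared ⊆ b.prepared) (hprep : ∀ q ∈ b.prepared, q ∈ a.prepared ∨ Committed net q)
    (hstore : m = Mode.lpbft → b.store = execAll svc (b.log.map PrePrepare.batch)) :
    ReplicaInv svc P m net' r b := by
  obtain ⟨lv, ha⟩ := ha
  have hlv : lv ≤ b.view := by rcases ha.log_view with h | h <;> omega
  have hs : ∀ pp, Sent net' r pp → Sent net r pp ∨ (pp ∈ b.log ∧ pp.view = b.view) := by
    rintro pp (hp | hp)
    · rcases hnew _ hp rfl with h | ⟨v, V, h⟩ | ⟨pp', h₁, h₂, h | h⟩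
      · exact Or.inl (Or.inl h)
      · cases h
      · cases h; exact Or.inr ⟨h₁, h₂⟩
      · cases h
    · rcases hnew _ hp rfl with h | ⟨v, V, h⟩ | ⟨pp', h₁, h₂, h | h⟩
      · exact Or.inl (Or.inr h)
      · cases h
      · cases h
      · cases h; exact Or.inr ⟨h₁, h₂⟩
  -- An old signature in view `b.view` exists only if `r` was already active in that view: during a
  -- view change its ledger, and with it everything it signed, belongs to an earlier view.
  have hmem : ∀ pp, Sent net' r pp → pp.view = b.view → pp ∈ b.log := by
    intro pp hp hv
    rcases hs pp hp with hp | hp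
    · obtain ⟨h₁, h₂, -⟩ := ha.sent pp hp
      rcases ha.log_view with ⟨h₃, h₄⟩ | ⟨h₃, h₄⟩
      · exact hlog h₃ pp (h₂ (by omega))
      · omega
    · exact hp.1
  have hc : ∀ v s, Msg.commit r v s ∈ net' → Msg.commit r v s ∈ net := by
    intro v s hc
    rcases hnew _ hc rfl with h | ⟨v, V, h⟩ | ⟨pp', h₁, h₂, h | h⟩
    · exact h
    all_goals cases h
  refine ⟨b.view, Or.inl ⟨hready, rfl⟩, hok, fun pp hp => ⟨?_, hmem pp hp, ?_⟩,
    fun pp pp₁ hp hp₁ hv hsq => ?_, fun v s hc' => ?_, fun q hq => ?_, fun v R hv => ?_, hstore⟩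
  · rcases hs pp hp with hp | hp
    · exact (ha.sent pp hp).1.trans hlv
    · exact hp.2.le
  · rcases hs pp hp with hp | hp
    · obtain ⟨-, -, log, h₁, h₂⟩ := ha.sent pp hp
      exact ⟨log, h₁.mono h, h₂⟩
    · exact ⟨b.log, hp.2 ▸ hok, hp.1⟩
  -- In the current view both lie in the new ledger, where positions are unique; in earlier views
  -- both signatures are old.
  · by_cases hb : pp.view = b.view
    · exact hok.eq_of_seq_eq (hmem pp hp hb) (hmem pp₁ hp₁ (hv ▸ hb)) hsq
    · exact ha.sent_unique pp pp₁ ((hs _ hp).resolve_right fun h => hb h.2)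
        ((hs _ hp₁).resolve_right fun h => hb (hv.trans h.2)) hv hsq
  · have := ha.commit v s (hc v s hc')
    exact ⟨this.1.trans hlv, this.2.mono h hsub⟩
  · rcases hprep q hq with hq | hq
    · exact (ha.prepared q hq).imp (fun h' => h'.mono h) fun h' => ⟨h'.1.mono h, h h'.2⟩
    · exact Or.inl (hq.mono h)
  · have hv' : Msg.viewChange r v R ∈ net := by
      rcases hnew _ hv rfl with h | ⟨v, V, h⟩ | ⟨pp', h₁, h₂, h | h⟩
      · exact h
      all_goals cases h
    obtain ⟨h₁, n, h₂, h₃⟩ := ha.viewChange v R hv'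
    exact ⟨h₁.trans hview.ge, n, h₂, fun v₁ s hc' => h₃ v₁ s (hc _ _ hc')⟩

theorem LogOK.concat (h : net ⊆ net') {v : ℕ} {log : List (PrePrepare Tx Res)}
    (hl : LogOK svc P m net r v log) {pp : PrePrepare Tx Res} (hview : pp.view = v)
    (hseq : pp.seq = log.length + 1) (hsent : Sent net' r pp) (hearly : m = Mode.lpbft →
      pp.early = some (outcome svc (log.map PrePrepare.batch) pp.batch)) :
    LogOK svc P m net' r v (log ++ [pp]) := by
  obtain ⟨n, h₁, h₂, h₃⟩ := hl.mono h
  refine ⟨n, h₁.trans (by simp), ?_, ?_⟩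
  · refine h₂.imp_right fun ⟨V, hV, hn, h₄⟩ => ⟨V, hV, hn, fun q hq hq₁ hq₂ => ?_⟩
    rcases List.mem_append.1 hq with hq | hq
    · exact h₄ q hq hq₁ hq₂
    -- The new entry lies beyond the `n ≤ log.length` batches with which the view was entered, so it
    -- needs no pick.
    · obtain rfl := List.mem_singleton.1 hq
      omega
  · intro i q hi
    rcases lt_trichotomy i log.length with hlt | rfl | hgt
    · rw [List.getElem?_append_left hlt] at hi
      rw [List.take_append_of_le_length hlt.le]
      exact h₃ i q hi
    · simp at hi
      subst hi
      exact ⟨hseq, Or.inr ⟨by omega, hview, hsent, by simpa using hearly⟩⟩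
    · rw [List.getElem?_eq_none (by simp; omega)] at hi
      cases hi

/-- The invariant is preserved when `r` signs the next batch. -/
theorem ReplicaInv.sign (ha : ReplicaInv svc P m net r a) {pp : PrePrepare Tx Res}
    {σ : Store Tx Res St} {x : Msg N Tx Res} (hready : a.ready = true) (hview : pp.view = a.view)
    (hseq : pp.seq = a.log.length + 1) (hexec : PreExec svc m a.store pp σ)
    (hx : x = Msg.prePrepare r pp ∨ x = Msg.prepare r pp) :
    ReplicaInv svc P m (net ∪ {x}) r { a with log := a.log ++ [pp], store := σ } := by
  obtain ⟨lv, ha'⟩ := id ha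
  have hlv : lv = a.view := by rcases ha'.log_view with h | h <;> simp_all
  have hex : m = Mode.lpbft → pp.early = some (outcome svc (a.log.map PrePrepare.batch) pp.batch) ∧
      σ = execAll svc (a.log.map PrePrepare.batch ++ [pp.batch]) := by
    rintro rfl
    rw [ha'.store rfl] at hexec
    exact preExec_execAll svc hexec
  refine ha.updateLog Set.subset_union_left ?_ hready rfl (fun _ q hq => by simp [hq]) ?_
    subset_rfl (fun q hq => Or.inl hq) (fun hm => by simpa using (hex hm).2)
  · rintro y (hy | rfl) -
    · exact Or.inl hy
    · exact Or.inr (Or.inr ⟨pp, by simp, hview, hx⟩)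
  · refine LogOK.concat Set.subset_union_left (hlv ▸ ha'.log_ok) hview hseq ?_
      fun hm => (hex hm).1
    exact hx.imp (fun h => Or.inr h.symm) fun h => Or.inr h.symm

theorem ReplicaInv.updateStore (ha : ReplicaInv svc P m net r a) {σ : Store Tx Res St}
    (hσ : m = Mode.lpbft → σ = a.store) : ReplicaInv svc P m net r { a with store := σ } := by
  obtain ⟨lv, ha⟩ := ha
  exact ⟨lv, ha.log_view, ha.log_ok, ha.sent, ha.sent_unique, ha.commit, ha.prepared,
    ha.viewChange, fun hm => (hσ hm).trans (ha.store hm)⟩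

/-- The invariant is preserved when `r` reveals a nonce. -/
theorem ReplicaInv.reveal (ha : ReplicaInv svc P m net r a) {pp : PrePrepare Tx Res}
    (hready : a.ready = true) (hview : pp.view = a.view) (hlog : pp ∈ a.log)
    (hprep : Prepared net pp) (hlow : ∀ q ∈ a.log, q.seq < pp.seq → q ∈ a.prepared) :
    ReplicaInv svc P m (net ∪ {Msg.commit r pp.view pp.seq}) r
      { a with prepared := a.prepared ∪ {pp} } := by
  obtain ⟨lv, ha⟩ := ha
  have h : net ⊆ net ∪ {Msg.commit r pp.view pp.seq} := Set.subset_union_left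
  have hlv : lv = a.view := by rcases ha.log_view with h | h <;> simp_all
  subst hlv
  have hs : ∀ q, Sent (net ∪ {Msg.commit r pp.view pp.seq}) r q → Sent net r q := by
    rintro q ((hq | hq) | (hq | hq))
    · exact Or.inl hq
    · cases hq
    · exact Or.inr hq
    · cases hq
  have hp : ∀ q ∈ a.prepared, Committed (net ∪ {Msg.commit r pp.view pp.seq}) q ∨
      (Prepared (net ∪ {Msg.commit r pp.view pp.seq}) q ∧
        Msg.commit r q.view q.seq ∈ net ∪ {Msg.commit r pp.view pp.seq}) := fun q hq =>
    (ha.prepared q hq).imp (fun h' => h'.mono h) fun h' => ⟨h'.1.mono h, h h'.2⟩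
  refine ⟨a.view, ha.log_view, ha.log_ok.mono h, fun q hq => ?_, fun q q₁ hq hq₁ => ?_,
    fun v s hc => ?_, fun q hq => ?_, fun v R hv => ?_, ha.store⟩
  · obtain ⟨h₁, h₂, log, h₃, h₄⟩ := ha.sent q (hs q hq)
    exact ⟨h₁, h₂, log, h₃.mono h, h₄⟩
  · exact ha.sent_unique q q₁ (hs _ hq) (hs _ hq₁)
  · rcases hc with hc | hc
    · have := ha.commit v s hc
      exact ⟨this.1, this.2.mono h Set.subset_union_left⟩
    · cases hc
      exact ⟨hview.le, a.log, pp, hview ▸ ha.log_ok.mono h, hlog, rfl, rfl, hprep.mono h,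
        Or.inr rfl, fun q hq hlt => hp q (hlow q hq hlt)⟩
  · rcases hq with hq | rfl
    · exact hp q hq
    · exact Or.inr ⟨hprep.mono h, Or.inr rfl⟩
  · rcases hv with hv | hv
    · obtain ⟨h₁, n, h₂, h₃⟩ := ha.viewChange v R hv
      refine ⟨h₁, n, h₂, fun v₁ s hc hlt => ?_⟩
      rcases hc with hc | hc
      · exact h₃ v₁ s hc hlt
      -- The new nonce is for the current view, which is not below the target view of any view
      -- change sent so far.
      · cases hc
        omega
    · cases hv

/-- The invariant is preserved when `r` leaves its view. -/
theorem ReplicaInv.leaveView (ha : ReplicaInv svc P m net r a) {v : ℕ}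
    {R : List (PrePrepare Tx Res)} (hv : a.view < v) (hR : IsReport P a.prepared R) :
    ReplicaInv svc P m (net ∪ {Msg.viewChange r v R}) r { a with view := v, ready := false } := by
  obtain ⟨lv, ha⟩ := ha
  have h : net ⊆ net ∪ {Msg.viewChange r v R} := Set.subset_union_left
  have hs : ∀ q, Sent (net ∪ {Msg.viewChange r v R}) r q → Sent net r q := by
    rintro q ((hq | hq) | (hq | hq))
    · exact Or.inl hq
    · cases hq
    · exact Or.inr hq
    · cases hq
  have hc : ∀ v₁ s, Msg.commit r v₁ s ∈ net ∪ {Msg.viewChange r v R} →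
      Msg.commit r v₁ s ∈ net := by
    rintro v₁ s (h | h)
    · exact h
    · cases h
  have hlv : lv < v := by rcases ha.log_view with h | h <;> omega
  refine ⟨lv, Or.inr ⟨rfl, hlv⟩, ha.log_ok.mono h, fun q hq => ?_,
    fun q q₁ hq hq₁ => ?_, fun v s hc' => ?_, fun q hq => ?_, fun v' R' hv' => ?_, ha.store⟩
  · obtain ⟨h₁, h₂, log, h₃, h₄⟩ := ha.sent q (hs q hq)
    exact ⟨h₁, h₂, log, h₃.mono h, h₄⟩
  · exact ha.sent_unique q q₁ (hs _ hq) (hs _ hq₁)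
  · have := ha.commit v s (hc _ _ hc')
    exact ⟨this.1, this.2.mono h subset_rfl⟩
  · exact (ha.prepared q hq).imp (fun h' => h'.mono h) fun h' => ⟨h'.1.mono h, h h'.2⟩
  · rcases hv' with hv' | hv'
    · obtain ⟨h₁, n, h₂, h₃⟩ := ha.viewChange v' R' hv'
      exact ⟨h₁.trans hv.le, n, h₂, fun v₁ s hc' => h₃ v₁ s (hc _ _ hc')⟩
    · cases hv'
      obtain ⟨n, h₁, h₂, h₃⟩ := hR
      refine ⟨le_rfl, n, h₁, fun v₁ s hc' _ => ?_⟩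
      -- Every revealed nonce has its pre-prepare in `a.prepared`, over which the report takes
      -- maxima of sequence numbers and views.
      obtain ⟨-, log, pp, -, -, rfl, rfl, -, hpp, -⟩ := ha.commit v₁ s (hc _ _ hc')
      exact ⟨h₂ pp hpp, fun q hq hqs => (h₃ q hq).2 pp hpp hqs.symm⟩

end Invariant

/-! ### Agreement, persistence across views, and the history behind a committed batch. -/

section Safety

variable {N : ℕ} [NeZero N] {Tx : Type u} {Res : Type v} {St : Type w}
  {svc : Service Tx Res St} {P : ℕ} {m : Mode} {byz : Finset (Fin N)} {c : Config N Tx Res St}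

/-- The invariant of a configuration. -/
def Inv (svc : Service Tx Res St) (P : ℕ) (m : Mode) (byz : Finset (Fin N))
    (c : Config N Tx Res St) : Prop :=
  ∀ r, r ∉ byz → ReplicaInv svc P m c.net r (c.rep r)

/-- All correct replicas of some quorum have signed the batch and have revealed their nonces. -/
def WeaklyCommitted (byz : Finset (Fin N)) (net : Set (Msg N Tx Res)) (pp : PrePrepare Tx Res) :
    Prop :=
  ∃ Q : Finset (Fin N), N - faults N ≤ Q.card ∧ ∀ r ∈ Q, r ∉ byz →
    Sent net r pp ∧ Msg.commit r pp.view pp.seq ∈ net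

theorem Committed.weaklyCommitted {net : Set (Msg N Tx Res)} {pp : PrePrepare Tx Res}
    (h : Committed net pp) : WeaklyCommitted byz net pp := by
  obtain ⟨Q, h₁, h₂⟩ := h
  exact ⟨Q, h₁, fun r hr _ => ⟨(h₂ r hr).1.sent, (h₂ r hr).2⟩⟩

theorem Inv.sent_unique (hc : Inv svc P m byz c) {r : Fin N} (hr : r ∉ byz)
    {pp pp₁ : PrePrepare Tx Res} (h : Sent c.net r pp) (h₁ : Sent c.net r pp₁)
    (hv : pp.view = pp₁.view) (hs : pp.seq = pp₁.seq) : pp = pp₁ := by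
  obtain ⟨lv, ha⟩ := hc r hr
  exact ha.sent_unique pp pp₁ h h₁ hv hs

theorem Inv.exists_logOK (hc : Inv svc P m byz c) {r : Fin N} (hr : r ∉ byz)
    {pp : PrePrepare Tx Res} (h : Sent c.net r pp) :
    ∃ log, LogOK svc P m c.net r pp.view log ∧ pp ∈ log := by
  obtain ⟨lv, ha⟩ := hc r hr
  exact (ha.sent pp h).2.2

/-- Membership in the local `prepared` set matters only when a report is made, so it is forgotten
here by enlarging the set to `Set.univ`. -/
theorem Inv.commitOK (hc : Inv svc P m byz c) {r : Fin N} (hr : r ∉ byz) {v s : ℕ}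
    (h : Msg.commit r v s ∈ c.net) : CommitOK svc P m c.net r Set.univ v s := by
  obtain ⟨lv, ha⟩ := hc r hr
  exact (ha.commit v s h).2.mono subset_rfl (Set.subset_univ _)

theorem Inv.reportOK (hc : Inv svc P m byz c) {r : Fin N} (hr : r ∉ byz) {v : ℕ}
    {R : List (PrePrepare Tx Res)} (h : Msg.viewChange r v R ∈ c.net) :
    ReportOK P c.net r v R := by
  obtain ⟨lv, ha⟩ := hc r hr
  exact (ha.viewChange v R h).2

theorem LogOK.committed_or_sent {net : Set (Msg N Tx Res)} {r : Fin N} {v : ℕ}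
    {log : List (PrePrepare Tx Res)} (h : LogOK svc P m net r v log) {q : PrePrepare Tx Res}
    (hq : q ∈ log) : (q.view < v ∧ Committed net q) ∨ (q.view = v ∧ Sent net r q) := by
  obtain ⟨n, -, -, h₃⟩ := h
  obtain ⟨i, hi⟩ := List.mem_iff_getElem?.1 hq
  exact (h₃ i q hi).2.imp And.right fun h => ⟨h.2.1, h.2.2.1⟩

theorem LogOK.view_le_of_mem {net : Set (Msg N Tx Res)} {r : Fin N} {v : ℕ}
    {log : List (PrePrepare Tx Res)} (h : LogOK svc P m net r v log) {q : PrePrepare Tx Res}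
    (hq : q ∈ log) : q.view ≤ v := by
  rcases h.committed_or_sent hq with h | h
  · exact h.1.le
  · exact h.1.le

theorem LogOK.early_eq {net : Set (Msg N Tx Res)} {r : Fin N} {v : ℕ}
    {log : List (PrePrepare Tx Res)} (h : LogOK svc P Mode.lpbft net r v log) {i : ℕ}
    {q : PrePrepare Tx Res} (hq : log[i]? = some q) (hv : q.view = v) :
    q.early = some (outcome svc ((log.take i).map PrePrepare.batch) q.batch) := by
  obtain ⟨n, -, -, h₃⟩ := h
  rcases (h₃ i q hq).2 with h | h
  · exact absurd hv h.2.1.ne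
  · exact h.2.2.2 rfl

theorem LogOK.seq_eq {net : Set (Msg N Tx Res)} {r : Fin N} {v : ℕ}
    {log : List (PrePrepare Tx Res)} (h : LogOK svc P m net r v log) {i : ℕ}
    {q : PrePrepare Tx Res} (hq : log[i]? = some q) : q.seq = i + 1 := by
  obtain ⟨n, -, -, h₃⟩ := h
  exact (h₃ i q hq).1

theorem LogOK.getElem?_seq {net : Set (Msg N Tx Res)} {r : Fin N} {v : ℕ}
    {log : List (PrePrepare Tx Res)} (h : LogOK svc P m net r v log) {q : PrePrepare Tx Res}
    (hq : q ∈ log) : 1 ≤ q.seq ∧ log[q.seq - 1]? = some q := by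
  obtain ⟨i, hi⟩ := List.mem_iff_getElem?.1 hq
  have := h.seq_eq hi
  exact ⟨by omega, by rwa [this, Nat.add_sub_cancel]⟩

/-- Two batches that prepared in the same view with the same sequence number are equal. -/
theorem Inv.prepared_unique (hbyz : byz.card ≤ faults N) (hc : Inv svc P m byz c)
    {pp pp₁ : PrePrepare Tx Res} (h : Prepared c.net pp) (h₁ : Prepared c.net pp₁)
    (hv : pp.view = pp₁.view) (hs : pp.seq = pp₁.seq) : pp = pp₁ := by
  obtain ⟨Q, hQ, -, h⟩ := h
  obtain ⟨Q₁, hQ₁, -, h₁⟩ := h₁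
  obtain ⟨r, hr, hrQ, hrQ₁⟩ := exists_correct_mem_inter hbyz hQ hQ₁
  exact hc.sent_unique hr (h r hrQ).sent (h₁ r hrQ₁).sent hv hs

/-- The ledger and the preparation evidence behind a revealed nonce, for the batch that was
signed. -/
theorem Inv.exists_log_of_commit (hc : Inv svc P m byz c) {r : Fin N} (hr : r ∉ byz)
    {pp : PrePrepare Tx Res} (hs : Sent c.net r pp) (h : Msg.commit r pp.view pp.seq ∈ c.net) :
    ∃ log, LogOK svc P m c.net r pp.view log ∧ pp ∈ log ∧ Prepared c.net pp ∧
      ∀ q ∈ log, q.seq < pp.seq →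
        Committed c.net q ∨ (Prepared c.net q ∧ Msg.commit r q.view q.seq ∈ c.net) := by
  obtain ⟨log, pp₁, h₁, h₂, h₃, h₄, h₅, -, h₆⟩ := hc.commitOK hr h
  rcases h₁.committed_or_sent h₂ with h₇ | h₇
  · exact absurd h₃ h₇.1.ne
  · obtain rfl := hc.sent_unique hr hs h₇.2 h₃.symm h₄.symm
    exact ⟨log, h₁, h₂, h₅, h₆⟩

theorem WeaklyCommitted.prepared (hbyz : byz.card ≤ faults N) (hc : Inv svc P m byz c)
    {pp : PrePrepare Tx Res} (h : WeaklyCommitted byz c.net pp) : Prepared c.net pp := by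
  obtain ⟨Q, hQ, h⟩ := h
  obtain ⟨r, hr, hrQ⟩ := exists_correct_mem hbyz hQ
  obtain ⟨log, -, -, hp, -⟩ := hc.exists_log_of_commit hr (h r hrQ hr).1 (h r hrQ hr).2
  exact hp

/-- A batch that is committed before view `v` is in the ledger of every correct replica in `v`. -/
def Persists (svc : Service Tx Res St) (P : ℕ) (m : Mode) (byz : Finset (Fin N))
    (net : Set (Msg N Tx Res)) (v : ℕ) : Prop :=
  ∀ pp, WeaklyCommitted byz net pp → pp.view < v → ∀ r log, r ∉ byz →
    LogOK svc P m net r v log → ∃ q ∈ log, q.seq = pp.seq ∧ q.batch = pp.batch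

/-- In the same view this is uniqueness of prepared batches. In a later view some correct replica
signed `pp₁` in a ledger of that view, and persistence puts the requests of `pp` at the same
position. -/
theorem Persists.batch_eq_of_prepared (hbyz : byz.card ≤ faults N) (hc : Inv svc P m byz c)
    {pp pp₁ : PrePrepare Tx Res} (hp : Persists svc P m byz c.net pp₁.view)
    (h : WeaklyCommitted byz c.net pp) (h₁ : Prepared c.net pp₁) (hs : pp₁.seq = pp.seq)
    (hv : pp.view ≤ pp₁.view) : pp₁.batch = pp.batch := by
  rcases hv.eq_or_lt with hv | hv
  · rw [hc.prepared_unique hbyz (h.prepared hbyz hc) h₁ hv hs.symm]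
  · obtain ⟨Q, hQ, -, h₂⟩ := h₁
    obtain ⟨r, hr, hrQ⟩ := exists_correct_mem hbyz hQ
    obtain ⟨log, hl, hm⟩ := hc.exists_logOK hr (h₂ r hrQ).sent
    obtain ⟨q, hq, hqs, hqb⟩ := hp pp h hv r log hr hl
    rw [← hqb, hl.eq_of_seq_eq hq hm (hqs.trans hs.symm)]

theorem mem_of_map_seq_eq_range' {R : List (PrePrepare Tx Res)} {a k s : ℕ}
    (hR : R.map PrePrepare.seq = List.range' a k) (h₁ : a ≤ s) (h₂ : s < a + k) :
    ∃ q ∈ R, q.seq = s := by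
  have : s ∈ R.map PrePrepare.seq := by
    rw [hR, List.mem_range'_1]
    exact ⟨h₁, h₂⟩
  simpa using this

/-- Committed batches survive view changes. -/
theorem Inv.persists (hP : 1 ≤ P) (hbyz : byz.card ≤ faults N) (hc : Inv svc P m byz c) (v : ℕ) :
    Persists svc P m byz c.net v := by
  induction v using Nat.strong_induction_on with
  | _ v ih =>
  intro pp hpp hv r log hr hlog
  obtain ⟨n, hn, hentry, hlog'⟩ := id hlog
  rcases hentry with ⟨rfl, -⟩ | ⟨V, hV, hlast, hpick⟩
  · omega
  -- `r₀` is correct, revealed its nonce for `pp`, and its report is among those from which `v` was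
  -- entered.
  obtain ⟨Q, hQ, hQpp⟩ := id hpp
  obtain ⟨r₀, hr₀, hrV, hrQ⟩ := exists_correct_mem_inter hbyz hV.1 hQ
  obtain ⟨R, hR⟩ := Option.isSome_iff_exists.1 (Finset.mem_filter.1 hrV).2
  obtain ⟨nR, hseqR, hrep⟩ := hc.reportOK hr₀ (hV.2 r₀ R hR).1
  obtain ⟨hle, hview⟩ := hrep pp.view pp.seq (hQpp r₀ hrQ hr₀).2 hv
  obtain ⟨log₀, hlog₀, hmem₀⟩ := hc.exists_logOK hr₀ (hQpp r₀ hrQ hr₀).1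
  have hpos := (hlog₀.getElem?_seq hmem₀).1
  -- Since `1 ≤ pp.seq ≤ nR` and `1 ≤ P`, the report of `r₀` is non-empty and contains an entry at
  -- `nR`.
  have hnR : nR ≤ n := by
    obtain ⟨q, hq, hqs⟩ := mem_of_map_seq_eq_range' hseqR (s := nR) (by omega) (by omega)
    exact hqs ▸ hlast.1 q ⟨r₀, R, hR, hq⟩
  have hlt : pp.seq - 1 < log.length := by omega
  have hget : log[pp.seq - 1]? = some log[pp.seq - 1] := List.getElem?_eq_getElem hlt
  have hmem : log[pp.seq - 1] ∈ log := List.getElem_mem hlt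
  generalize log[pp.seq - 1] = q at hget hmem
  have hqs : q.seq = pp.seq := by
    have := hlog.seq_eq hget
    omega
  refine ⟨q, hmem, hqs, ?_⟩
  -- If `q` has commitment evidence, the induction hypothesis is used at the larger of the views of
  -- `q` and `pp`, both below `v`.
  rcases (hlog' _ q hget).2 with ⟨-, hqv, hq⟩ | ⟨hlow, hqv, hq, -⟩
  · have hqw : WeaklyCommitted byz c.net q := hq.weaklyCommitted
    rcases le_total pp.view q.view with hle' | hle'
    · exact (ih q.view hqv).batch_eq_of_prepared hbyz hc hpp (hqw.prepared hbyz hc) hqs hle'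
    · exact ((ih pp.view hv).batch_eq_of_prepared hbyz hc hqw (hpp.prepared hbyz hc)
        hqs.symm hle').symm
  -- Otherwise the batch was picked. As `nR - P ≤ n - P < pp.seq ≤ nR`, the report of `r₀` covers
  -- this position, with view at least `pp.view`; the pick is prepared in a view at least as large,
  -- and below `v`.
  · obtain ⟨q₁, ⟨⟨r₁, R₁, hR₁, hqR₁⟩, hmax⟩, hq₁s, hq₁b⟩ := hpick q hmem hlow (by omega)
    obtain ⟨q₂, hq₂, hq₂s⟩ := mem_of_map_seq_eq_range' hseqR (s := pp.seq) (by omega) (by omega)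
    have hle₁ := hview q₂ hq₂ hq₂s
    have hle₂ := hmax q₂ ⟨r₀, R, hR, hq₂⟩ (by omega)
    obtain ⟨hq₁v, hq₁p⟩ := (hV.2 r₁ R₁ hR₁).2.2 q₁ hqR₁
    rw [← hq₁b]
    exact (ih q₁.view hq₁v).batch_eq_of_prepared hbyz hc hpp hq₁p (by omega) (by omega)

/-- Agreement on committed batches. -/
theorem Inv.batch_eq (hP : 1 ≤ P) (hbyz : byz.card ≤ faults N) (hc : Inv svc P m byz c)
    {pp pp₁ : PrePrepare Tx Res} (h : WeaklyCommitted byz c.net pp)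
    (h₁ : WeaklyCommitted byz c.net pp₁) (hs : pp₁.seq = pp.seq) : pp₁.batch = pp.batch := by
  rcases le_total pp.view pp₁.view with hv | hv
  · exact (hc.persists hP hbyz _).batch_eq_of_prepared hbyz hc h (h₁.prepared hbyz hc) hs hv
  · exact ((hc.persists hP hbyz _).batch_eq_of_prepared hbyz hc h₁ (h.prepared hbyz hc)
      hs.symm hv).symm

/-- With early execution a committed batch carries the outcome of executing it after some batches
that are themselves (weakly) committed. -/
theorem Inv.exists_outcome (hbyz : byz.card ≤ faults N) (hc : Inv svc P Mode.lpbft byz c)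
    {pp : PrePrepare Tx Res} (h : WeaklyCommitted byz c.net pp) :
    ∃ Bs : List (List Tx), pp.early = some (outcome svc Bs pp.batch) ∧ pp.seq = Bs.length + 1 ∧
      ∀ i B, Bs[i]? = some B → ∃ q, WeaklyCommitted byz c.net q ∧ q.seq = i + 1 ∧
        q.view ≤ pp.view ∧ q.batch = B := by
  obtain ⟨Q, hQ, h⟩ := h
  have key : ∀ r ∈ Q, r ∉ byz → ∃ log, LogOK svc P Mode.lpbft c.net r pp.view log ∧
      log[pp.seq - 1]? = some pp ∧ 1 ≤ pp.seq ∧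
      pp.early = some (outcome svc ((log.take (pp.seq - 1)).map PrePrepare.batch) pp.batch) ∧
      ∀ q ∈ log, q.seq < pp.seq →
        Committed c.net q ∨ (Prepared c.net q ∧ Msg.commit r q.view q.seq ∈ c.net) := by
    intro r hrQ hr
    obtain ⟨log, hl, hm, -, hlow⟩ := hc.exists_log_of_commit hr (h r hrQ hr).1 (h r hrQ hr).2
    obtain ⟨hpos, hget⟩ := hl.getElem?_seq hm
    exact ⟨log, hl, hget, hpos, hl.early_eq hget rfl, hlow⟩
  obtain ⟨r₀, hr₀, hr₀Q⟩ := exists_correct_mem hbyz hQ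
  obtain ⟨log₀, hl₀, hget₀, hpos, he₀, hlow₀⟩ := key r₀ hr₀Q hr₀
  have hlt₀ : pp.seq - 1 < log₀.length := (List.getElem?_eq_some_iff.1 hget₀).1
  refine ⟨_, he₀, by simp; omega, fun i B hB => ?_⟩
  have hi : i < pp.seq - 1 := by
    have := (List.getElem?_eq_some_iff.1 hB).1
    simp at this
    omega
  have hentry : ∀ r ∈ Q, r ∉ byz → ∃ q, q.batch = B ∧ q.seq = i + 1 ∧ q.view ≤ pp.view ∧
      (Committed c.net q ∨ (q.view = pp.view ∧ Sent c.net r q ∧ Prepared c.net q ∧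
        Msg.commit r q.view q.seq ∈ c.net)) := by
    intro r hrQ hr
    obtain ⟨log, hl, hget, -, he, hlow⟩ := key r hrQ hr
    -- All correct members signed the same `pp`, hence the same `L`, hence had the same batches
    -- before it.
    have hBs := execAll_ledger_injective svc (congrArg Prod.fst (Option.some.inj (he₀.symm.trans he)))
    rw [hBs, List.getElem?_map, Option.map_eq_some_iff] at hB
    obtain ⟨q, hq, rfl⟩ := hB
    rw [List.getElem?_take_of_lt hi] at hq
    have hqm := List.mem_of_getElem? hq
    have hqs := hl.seq_eq hq
    refine ⟨q, rfl, hqs, hl.view_le_of_mem hqm, ?_⟩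
    rcases hlow q hqm (by omega) with h₁ | h₁
    · exact Or.inl h₁
    · exact (hl.committed_or_sent hqm).imp And.right fun h₂ => ⟨h₂.1, h₂.2, h₁⟩
  -- Commitment evidence known to one member suffices. Without any, each correct member of `Q` holds
  -- an entry prepared in `pp.view`; these entries coincide, so the same `Q` witnesses weak
  -- commitment.
  by_cases hex : ∃ q, q.batch = B ∧ q.seq = i + 1 ∧ q.view ≤ pp.view ∧ Committed c.net q
  · obtain ⟨q, h₁, h₂, h₃, h₄⟩ := hex
    exact ⟨q, h₄.weaklyCommitted, h₂, h₃, h₁⟩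
  · have hentry' : ∀ r ∈ Q, r ∉ byz → ∃ q, q.batch = B ∧ q.seq = i + 1 ∧ q.view = pp.view ∧
        Sent c.net r q ∧ Prepared c.net q ∧ Msg.commit r q.view q.seq ∈ c.net := by
      intro r hrQ hr
      obtain ⟨q, h₁, h₂, h₃, h₄ | h₄⟩ := hentry r hrQ hr
      · exact absurd ⟨q, h₁, h₂, h₃, h₄⟩ hex
      · exact ⟨q, h₁, h₂, h₄⟩
    obtain ⟨q, h₁, h₂, h₃, -, h₄, -⟩ := hentry' r₀ hr₀Q hr₀
    refine ⟨q, ⟨Q, hQ, fun r hrQ hr => ?_⟩, h₂, h₃.le, h₁⟩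
    obtain ⟨q', -, h₂', h₃', h₅, h₄', h₆⟩ := hentry' r hrQ hr
    obtain rfl := hc.prepared_unique hbyz h₄ h₄' (by omega) (by omega)
    exact ⟨h₅, h₆⟩

end Safety

/-! ### Every step preserves the invariant. -/

section Preservation

variable {N : ℕ} [NeZero N] {Tx : Type u} {Res : Type v} {St : Type w}
  {svc : Service Tx Res St} {P : ℕ} {m : Mode} {byz : Finset (Fin N)} {c : Config N Tx Res St}

theorem getElem?_seq_of_map_seq_eq_range' {R : List (PrePrepare Tx Res)} {a k i : ℕ}
    {q : PrePrepare Tx Res} (hR : R.map PrePrepare.seq = List.range' a k)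
    (hq : R[i]? = some q) : q.seq = a + i ∧ i < k := by
  have h : (R.map PrePrepare.seq)[i]? = some q.seq := by simp [hq]
  rw [hR, List.getElem?_eq_some_iff] at h
  obtain ⟨h₁, h₂⟩ := h
  simp at h₁ h₂
  omega

/-- Roll-back followed by re-execution is again an execution from the start, of some list of
batches. Its entries match those bound in `L`; comparing only the requests identifies this list with
the batches of `L`. -/
theorem Reset.eq_execAll {Bs : List (List Tx)} {L : List (PrePrepare Tx Res)}
    {σ : Store Tx Res St} (h : Reset svc Mode.lpbft (execAll svc Bs) L σ)
    (hL : ∀ q ∈ L, ∃ Cs, q.early = some (outcome svc Cs q.batch)) :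
    σ = execAll svc (L.map PrePrepare.batch) := by
  obtain ⟨⟨k, Ds, hσ⟩, hmap⟩ := h
  obtain ⟨Cs, hCs⟩ := rollback_execAll svc Bs k
  rw [hCs, ← execAll_append] at hσ
  have h₁ : (L.map fun q => q.early.map Prod.snd).map (Option.map (List.map Prod.fst)) =
      (L.map PrePrepare.batch).map some := by
    simp only [List.map_map]
    refine List.map_congr_left fun q hq => ?_
    obtain ⟨Es, hEs⟩ := hL q hq
    simp [hEs, outcome, Store.result_map_fst]
  have h₂ : (σ.ledger.map some).map (Option.map (List.map Prod.fst)) =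
      (Cs ++ Ds).map some := by
    rw [← execAll_ledger_requests svc (Cs ++ Ds), ← hσ]
    simp [Function.comp_def]
  rw [hmap, h₂] at h₁
  rw [hσ, List.map_injective_iff.2 (Option.some_injective _) h₁]

/-- The invariant is preserved when a correct replica enters its new view. -/
theorem Inv.enterView (hbyz : byz.card ≤ faults N) (hc : Inv svc P m byz c) {r : Fin N}
    (hr : r ∉ byz) {V : Fin N → Option (List (PrePrepare Tx Res))}
    {W : List (PrePrepare Tx Res)} {b : Replica Tx Res St} {out : Set (Msg N Tx Res)}
    (hready : (c.rep r).ready = false)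
    (henter : EnterView svc P m c.net (c.rep r).view V W (c.rep r) b)
    (hsent : ∀ pp ∈ W, Sent out r pp)
    (hout : ∀ x ∈ out, (∃ v V, x = Msg.newView r v V) ∨
      ∃ pp ∈ W, x = Msg.prePrepare r pp ∨ x = Msg.prepare r pp) :
    ReplicaInv svc P m (c.net ∪ out) r b := by
  obtain ⟨n, L, σ, τ, hV, hn, hLseq, hL, hreset, hWseq, hW, hexec, rfl⟩ := henter
  have hLlen : L.length = n - P := by simpa using congrArg List.length hLseq
  have hWlen : W.length = min n P := by simpa using congrArg List.length hWseq
  have hex : m = Mode.lpbft → τ = execAll svc ((L ++ W).map PrePrepare.batch) ∧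
      ∀ i q, W[i]? = some q → q.early = some (outcome svc
        ((L ++ W.take i).map PrePrepare.batch) q.batch) := by
    rintro rfl
    obtain ⟨lv, ha⟩ := hc r hr
    rw [ha.store rfl] at hreset
    -- Commitment evidence guarantees that the entries bound in `q` are a genuine outcome, so faulty
    -- replicas cannot make the reset adopt other requests.
    have hσ := hreset.eq_execAll fun q hq => by
      obtain ⟨Bs, hBs, -⟩ := hc.exists_outcome hbyz (hL q hq).2.weaklyCommitted
      exact ⟨Bs, hBs⟩
    rw [hσ] at hexec
    simpa using preExecAll_execAll svc hexec
  refine (hc r hr).updateLog Set.subset_union_left ?_ rfl rfl (by simp [hready]) ?_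
    Set.subset_union_left ?_ fun hm => (hex hm).1
  · rintro x (hx | hx) -
    · exact Or.inl hx
    · refine Or.inr ((hout x hx).imp_right ?_)
      rintro ⟨pp, hpp, hx⟩
      exact ⟨pp, by simp [hpp], (hW pp hpp).1, hx⟩
  · refine ⟨n, by simp [hLlen, hWlen],
      Or.inr ⟨V, hV.mono Set.subset_union_left, hn, fun q hq hq₁ hq₂ => ?_⟩, fun i q hq => ?_⟩
    · rcases List.mem_append.1 hq with hq | hq
      -- Entries of `L` have sequence number at most `n - P`, against `hq₁`.
      · obtain ⟨i, hi⟩ := List.mem_iff_getElem?.1 hq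
        have := getElem?_seq_of_map_seq_eq_range' hLseq hi
        omega
      · exact (hW q hq).2.2
    · rcases lt_or_ge i L.length with hlt | hge
      · rw [List.getElem?_append_left hlt] at hq
        have := getElem?_seq_of_map_seq_eq_range' hLseq hq
        have hq' := hL q (List.mem_of_getElem? hq)
        exact ⟨by omega, Or.inl ⟨by omega, hq'.1, hq'.2.mono Set.subset_union_left⟩⟩
      · rw [List.getElem?_append_right hge] at hq
        have := getElem?_seq_of_map_seq_eq_range' hWseq hq
        have hqW := List.mem_of_getElem? hq
        refine ⟨by omega, Or.inr ⟨by omega, (hW q hqW).1,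
          (hsent q hqW).mono Set.subset_union_right, fun hm => ?_⟩⟩
        rw [List.take_append, List.take_of_length_le hge]
        exact (hex hm).2 _ q hq
  · rintro q (hq | hq)
    · exact Or.inl hq
    · exact Or.inr (hL q hq).2

/-- Only `r` changes state and it signs everything in `out`, so `ReplicaInv.mono` covers the other
replicas. -/
theorem Inv.set (hc : Inv svc P m byz c) {r : Fin N} {b : Replica Tx Res St}
    {out : Set (Msg N Tx Res)} (hout : ∀ x ∈ out, x.signer = some r)
    (hb : ReplicaInv svc P m (c.net ∪ out) r b) : Inv svc P m byz (c.set r b out) := by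
  intro q hq
  by_cases h : q = r
  · subst h
    simpa [Config.set] using hb
  · have : ReplicaInv svc P m (c.net ∪ out) q (c.rep q) := by
      refine (hc q hq).mono Set.subset_union_left ?_
      rintro x (hx | hx) hs
      · exact hx
      · rw [hout x hx, Option.some.injEq] at hs
        exact absurd hs.symm h
    simpa [Config.set, h] using this

/-- The fault bound is needed only for entering a view, where the outcomes bound in the fetched
batches must be genuine. -/
theorem Inv.step (hbyz : byz.card ≤ faults N) (hc : Inv svc P m byz c) {c' : Config N Tx Res St}
    (h : Step svc P m byz c c') : Inv svc P m byz c' := by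
  cases h with
  | request t =>
    refine fun q hq => (hc q hq).mono Set.subset_union_left ?_
    rintro x (hx | rfl) hs
    · exact hx
    · cases hs
  | faulty r x hr hx =>
    refine fun q hq => (hc q hq).mono Set.subset_union_left ?_
    rintro y (hy | rfl) hs
    · exact hy
    · rw [hx, Option.some.injEq] at hs
      exact absurd (hs ▸ hr) hq
  | sendPrePrepare r pp σ hr hready hprimary hview hseq hne hreq hev hexec =>
    exact hc.set (by simp [Msg.signer]) ((hc r hr).sign hready hview hseq hexec (Or.inl rfl))
  | acceptPrePrepare r pp σ hr hready hbackup hview hseq hpp hreq hev hexec =>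
    exact hc.set (by simp [Msg.signer]) ((hc r hr).sign hready hview hseq hexec (Or.inr rfl))
  | rejectPrePrepare r pp hm hr hready hbackup hview hseq hpp hexec =>
    refine hc.set (by simp) ?_
    rw [Set.union_empty]
    exact (hc r hr).updateStore fun _ => Store.undoLast_exec svc _ _
  | batchPrepared r pp hr hready hview hlog hprep hlow =>
    exact hc.set (by simp [Msg.signer]) ((hc r hr).reveal hready hview hlog hprep hlow)
  | execCommitted r pp hm hr hcom hseq =>
    refine hc.set (by simp) ?_
    rw [Set.union_empty]
    exact (hc r hr).updateStore fun hm' => by simp [hm] at hm'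
  | sendViewChange r v R hr hv hR =>
    refine hc.set (by simp [Msg.signer]) ((hc r hr).leaveView ?_ hR)
    rcases hv with hv | hv
    · omega
    · exact hv.1
  | sendNewView r V W b hr hready hprimary henter =>
    refine hc.set ?_ (hc.enterView hbyz hr hready henter ?_ ?_)
    · rintro x (rfl | ⟨pp, -, rfl⟩) <;> rfl
    · exact fun pp hpp => Or.inl (Or.inr ⟨pp, hpp, rfl⟩)
    · rintro x (rfl | ⟨pp, hpp, rfl⟩)
      · exact Or.inl ⟨_, _, rfl⟩
      · exact Or.inr ⟨pp, hpp, Or.inl rfl⟩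
  | acceptNewView r V W b hr hready hbackup hnv hW henter =>
    refine hc.set ?_ (hc.enterView hbyz hr hready henter ?_ ?_)
    · rintro x ⟨pp, -, rfl⟩; rfl
    · exact fun pp hpp => Or.inr ⟨pp, hpp, rfl⟩
    · rintro x ⟨pp, hpp, rfl⟩
      exact Or.inr ⟨pp, hpp, Or.inr rfl⟩

theorem Inv.start : Inv svc P m byz (Config.start N svc) := by
  intro r _
  refine ⟨0, Or.inl ⟨rfl, rfl⟩, ⟨0, le_rfl, Or.inl ⟨rfl, rfl⟩, by simp [Config.start]⟩, ?_, ?_, ?_, ?_,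
    ?_, fun _ => rfl⟩ <;> simp [Config.start, Sent]

theorem Reachable.inv (hbyz : byz.card ≤ faults N) (h : Reachable svc P m byz c) :
    Inv svc P m byz c := by
  induction h with
  | refl => exact Inv.start
  | tail _ h ih => exact ih.step hbyz h

end Preservation

/-! ### Simulation of L-PBFT ordering by PBFT. -/

section Erase

variable {N : ℕ} {Tx : Type u} {Res : Type v} {St : Type w}
  {svc : Service Tx Res St} {P : ℕ} {byz : Finset (Fin N)}

/-- Forget the outcomes in the local state of a replica, and its executions. -/
def Replica.erase (svc : Service Tx Res St) (a : Replica Tx Res St) : Replica Tx Res St :=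
  ⟨a.view, a.ready, a.log.map PrePrepare.erase, PrePrepare.erase '' a.prepared, ⟨svc.start, []⟩⟩

/-- Forget all outcomes in a configuration, and all executions. -/
def Config.erase (svc : Service Tx Res St) (c : Config N Tx Res St) : Config N Tx Res St :=
  ⟨Msg.erase '' c.net, fun r => (c.rep r).erase svc⟩

theorem Config.erase_set (c : Config N Tx Res St) (r : Fin N) (b : Replica Tx Res St)
    (out : Set (Msg N Tx Res)) :
    (c.set r b out).erase svc = (c.erase svc).set r (b.erase svc) (Msg.erase '' out) := by
  simp only [Config.erase, Config.set, Set.image_union, Config.mk.injEq, true_and]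
  funext q
  by_cases h : q = r
  · subst h; simp
  · simp [h]

variable {net net' : Set (Msg N Tx Res)}

theorem Sent.erase {r : Fin N} {pp : PrePrepare Tx Res} (h : Sent net r pp) :
    Sent (Msg.erase '' net) r pp.erase :=
  h.imp (fun h => ⟨_, h, rfl⟩) fun h => ⟨_, h, rfl⟩

theorem HasRequests.erase {B : List Tx} (h : HasRequests net B) :
    HasRequests (Msg.erase '' net) B := fun t ht => ⟨_, h t ht, rfl⟩

theorem map_seq_map_erase (R : List (PrePrepare Tx Res)) :
    (R.map PrePrepare.erase).map PrePrepare.seq = R.map PrePrepare.seq := by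
  rw [List.map_map]; rfl

theorem signer_erase (x : Msg N Tx Res) : x.erase.signer = x.signer := by
  cases x <;> rfl

/-- Transfers the histories of L-PBFT batches into any PBFT run that contains at least the erased
messages. -/
theorem WeaklyCommitted.erase {pp : PrePrepare Tx Res} (h : WeaklyCommitted byz net pp)
    (hsub : Msg.erase '' net ⊆ net') : WeaklyCommitted byz net' pp.erase := by
  obtain ⟨Q, h₁, h₃⟩ := h
  exact ⟨Q, h₁, fun r hr hb => ⟨(h₃ r hr hb).1.erase.mono hsub, hsub ⟨_, (h₃ r hr hb).2, rfl⟩⟩⟩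

/-- Forget the outcomes in reports. -/
def eraseReports (V : Fin N → Option (List (PrePrepare Tx Res))) :
    Fin N → Option (List (PrePrepare Tx Res)) :=
  fun q => (V q).map (List.map PrePrepare.erase)

variable {V : Fin N → Option (List (PrePrepare Tx Res))}

theorem reported_eraseReports {q : PrePrepare Tx Res} :
    Reported (eraseReports V) q ↔ ∃ q₁, Reported V q₁ ∧ q = q₁.erase := by
  constructor
  · rintro ⟨r, R, hR, hq⟩
    replace hR := Option.map_eq_some_iff.1 hR
    obtain ⟨R, hR, rfl⟩ := hR
    replace hq := List.mem_map.1 hq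
    obtain ⟨q, hq, rfl⟩ := hq
    exact ⟨q, ⟨r, R, hR, hq⟩, rfl⟩
  · rintro ⟨q, ⟨r, R, hR, hq⟩, rfl⟩
    exact ⟨r, _, Option.map_eq_some_iff.2 ⟨R, hR, rfl⟩, List.mem_map_of_mem hq⟩

theorem IsLast.erase {n : ℕ} (h : IsLast V n) : IsLast (eraseReports V) n := by
  refine ⟨fun q hq => ?_, h.2.imp_right ?_⟩
  · replace hq := reported_eraseReports.1 hq
    obtain ⟨q, hq, rfl⟩ := hq
    exact h.1 q hq
  · rintro ⟨q, hq, hs⟩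
    exact ⟨q.erase, reported_eraseReports.2 ⟨q, hq, rfl⟩, hs⟩

theorem IsPick.erase {q : PrePrepare Tx Res} (h : IsPick V q) :
    IsPick (eraseReports V) q.erase := by
  refine ⟨reported_eraseReports.2 ⟨q, h.1, rfl⟩, fun q₁ hq₁ hs => ?_⟩
  replace hq₁ := reported_eraseReports.1 hq₁
  obtain ⟨q₁, hq₁, rfl⟩ := hq₁
  exact h.2 q₁ hq₁ hs

variable [NeZero N]

theorem Signed.erase {r : Fin N} {pp : PrePrepare Tx Res} (h : Signed net r pp) :
    Signed (Msg.erase '' net) r pp.erase :=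
  h.imp (fun h => ⟨h.1, _, h.2, rfl⟩) fun h => ⟨h.1, _, h.2, rfl⟩

theorem Prepared.erase {pp : PrePrepare Tx Res} (h : Prepared net pp) :
    Prepared (Msg.erase '' net) pp.erase := by
  obtain ⟨Q, h₁, h₂, h₃⟩ := h
  exact ⟨Q, h₁, h₂, fun r hr => (h₃ r hr).erase⟩

theorem Committed.erase {pp : PrePrepare Tx Res} (h : Committed net pp) :
    Committed (Msg.erase '' net) pp.erase := by
  obtain ⟨Q, h₁, h₃⟩ := h
  exact ⟨Q, h₁, fun r hr => ⟨(h₃ r hr).1.erase, _, (h₃ r hr).2, rfl⟩⟩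

theorem HasEvidence.erase {log : List (PrePrepare Tx Res)} {s : ℕ} (h : HasEvidence P net log s) :
    HasEvidence P (Msg.erase '' net) (log.map PrePrepare.erase) s := by
  intro q hq hs
  replace hq := List.mem_map.1 hq
  obtain ⟨q, hq, rfl⟩ := hq
  exact (h q hq hs).erase

theorem IsReport.erase {S : Set (PrePrepare Tx Res)} {R : List (PrePrepare Tx Res)}
    (h : IsReport P S R) : IsReport P (PrePrepare.erase '' S) (R.map PrePrepare.erase) := by
  obtain ⟨n, h₁, h₂, h₃⟩ := h
  refine ⟨n, (map_seq_map_erase R).trans h₁, ?_, ?_⟩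
  · rintro _ ⟨q, hq, rfl⟩
    exact h₂ q hq
  · intro q hq
    replace hq := List.mem_map.1 hq
    obtain ⟨q, hq, rfl⟩ := hq
    refine ⟨⟨q, (h₃ q hq).1, rfl⟩, ?_⟩
    rintro _ ⟨q₁, hq₁, rfl⟩ hs
    exact (h₃ q hq).2 q₁ hq₁ hs

theorem ValidReport.erase {v : ℕ} {R : List (PrePrepare Tx Res)} (h : ValidReport P net v R) :
    ValidReport P (Msg.erase '' net) v (R.map PrePrepare.erase) := by
  refine ⟨h.1.imp fun n hn => (map_seq_map_erase R).trans hn, fun q hq => ?_⟩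
  replace hq := List.mem_map.1 hq
  obtain ⟨q, hq, rfl⟩ := hq
  exact ⟨(h.2 q hq).1, (h.2 q hq).2.erase⟩

theorem ValidViewChanges.erase {v : ℕ} (h : ValidViewChanges P net v V) :
    ValidViewChanges P (Msg.erase '' net) v (eraseReports V) := by
  refine ⟨by simpa [eraseReports] using h.1, fun r R hR => ?_⟩
  replace hR := Option.map_eq_some_iff.1 hR
  obtain ⟨R, hR, rfl⟩ := hR
  exact ⟨⟨_, (h.2 r R hR).1, rfl⟩, (h.2 r R hR).2.erase⟩

theorem preExec_erase (σ : Store Tx Res St) (pp : PrePrepare Tx Res) :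
    PreExec svc Mode.pbft σ pp.erase σ := ⟨rfl, rfl⟩

theorem preExecAll_erase (σ : Store Tx Res St) (W : List (PrePrepare Tx Res)) :
    PreExecAll svc Mode.pbft σ (W.map PrePrepare.erase) σ := by
  induction W with
  | nil => rfl
  | cons pp W ih => exact ⟨σ, preExec_erase σ pp, ih⟩

theorem EnterView.erase {v : ℕ} {W : List (PrePrepare Tx Res)} {a b : Replica Tx Res St}
    (h : EnterView svc P Mode.lpbft net v V W a b) :
    EnterView svc P Mode.pbft (Msg.erase '' net) v (eraseReports V) (W.map PrePrepare.erase)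
      (a.erase svc) (b.erase svc) := by
  obtain ⟨n, L, σ, τ, hV, hn, hLseq, hL, -, hWseq, hW, -, rfl⟩ := h
  refine ⟨n, L.map PrePrepare.erase, ⟨svc.start, []⟩, ⟨svc.start, []⟩, hV.erase, hn.erase,
    (map_seq_map_erase L).trans hLseq, fun q hq => ?_, rfl, (map_seq_map_erase W).trans hWseq,
    fun q hq => ?_, preExecAll_erase _ W, ?_⟩
  · replace hq := List.mem_map.1 hq
    obtain ⟨q, hq, rfl⟩ := hq
    exact ⟨(hL q hq).1, (hL q hq).2.erase⟩
  · replace hq := List.mem_map.1 hq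
    obtain ⟨q, hq, rfl⟩ := hq
    obtain ⟨h₁, h₂, q₁, h₃, h₄, h₅⟩ := hW q hq
    exact ⟨h₁, h₂.erase, q₁.erase, h₃.erase, h₄, h₅⟩
  · simp only [Replica.erase, List.map_append, Set.image_union, Replica.mk.injEq, true_and,
      and_true]
    congr 1
    ext q
    simp

/-- Every step with early execution is a step without, up to outcomes and execution. -/
theorem Step.erase {c c' : Config N Tx Res St} (h : Step svc P Mode.lpbft byz c c') :
    Relation.ReflTransGen (Step svc P Mode.pbft byz) (c.erase svc) (c'.erase svc) := by
  cases h with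
  | request t =>
    refine .single ?_
    have := Step.request (svc := svc) (P := P) (m := .pbft) (byz := byz) (c.erase svc) t
    simpa [Config.erase, Set.image_insert_eq, Msg.erase] using this
  | faulty r x hr hx =>
    refine .single ?_
    have := Step.faulty (svc := svc) (P := P) (m := .pbft) (byz := byz) (c.erase svc) r x.erase hr
      ((signer_erase x).trans hx)
    simpa [Config.erase, Set.image_insert_eq] using this
  | sendPrePrepare r pp σ hr hready hprimary hview hseq hne hreq hev hexec =>
    refine .single ?_
    have := Step.sendPrePrepare (svc := svc) (P := P) (m := .pbft) (byz := byz) (c.erase svc) r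
      pp.erase _ hr hready hprimary hview (hseq.trans (by simp [Config.erase, Replica.erase])) hne
      hreq.erase hev.erase (preExec_erase _ pp)
    rw [Config.erase_set]
    simpa [Config.erase, Replica.erase, Msg.erase] using this
  | acceptPrePrepare r pp σ hr hready hbackup hview hseq hpp hreq hev hexec =>
    refine .single ?_
    have := Step.acceptPrePrepare (svc := svc) (P := P) (m := .pbft) (byz := byz) (c.erase svc) r
      pp.erase _ hr hready hbackup hview (hseq.trans (by simp [Config.erase, Replica.erase]))
      ⟨_, hpp, rfl⟩ hreq.erase hev.erase (preExec_erase _ pp)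
    rw [Config.erase_set]
    simpa [Config.erase, Replica.erase, Msg.erase] using this
  | rejectPrePrepare r pp hm hr hready hbackup hview hseq hpp hexec =>
    -- A rejection sends nothing and changes only the store, so it becomes the empty sequence of
    -- PBFT steps.
    rw [Config.erase_set]
    have : (c.erase svc).set r ((c.rep r).erase svc) (Msg.erase '' ∅) = c.erase svc := by
      simp [Config.erase, Config.set]
    exact Eq.subst (motive := Relation.ReflTransGen _ (c.erase svc)) this.symm .refl
  | batchPrepared r pp hr hready hview hlog hprep hlow =>
    refine .single ?_
    have := Step.batchPrepared (svc := svc) (P := P) (m := .pbft) (byz := byz) (c.erase svc) r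
      pp.erase hr hready hview (List.mem_map_of_mem hlog) hprep.erase (by
        intro q hq hs
        replace hq := List.mem_map.1 hq
        obtain ⟨q, hq, rfl⟩ := hq
        exact ⟨q, hlow q hq hs, rfl⟩)
    rw [Config.erase_set]
    simpa [Config.erase, Replica.erase, Msg.erase, Set.image_union, PrePrepare.erase,
      Set.image_insert_eq] using this
  | execCommitted r pp hm hr hcom hseq => cases hm
  | sendViewChange r v R hr hv hR =>
    refine .single ?_
    have := Step.sendViewChange (svc := svc) (P := P) (m := .pbft) (byz := byz) (c.erase svc) r v
      (R.map PrePrepare.erase) hr (by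
        refine hv.imp_right fun ⟨h₁, Q, h₂, h₃⟩ => ⟨h₁, Q, h₂, fun q hq => ?_⟩
        obtain ⟨R₁, h₄, h₅⟩ := h₃ q hq
        exact ⟨R₁.map PrePrepare.erase, ⟨_, h₄, rfl⟩, h₅.erase⟩) hR.erase
    rw [Config.erase_set]
    simpa [Config.erase, Replica.erase, Msg.erase] using this
  | sendNewView r V W b hr hready hprimary henter =>
    refine .single ?_
    have := Step.sendNewView (svc := svc) (P := P) (m := .pbft) (byz := byz) (c.erase svc) r
      (eraseReports V) (W.map PrePrepare.erase) (b.erase svc) hr hready hprimary henter.erase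
    rw [Config.erase_set]
    convert this using 2
    ext x
    simp only [Set.image_union, Set.image_singleton, Set.mem_union, Set.mem_image]
    refine or_congr Iff.rfl ⟨?_, ?_⟩
    · rintro ⟨_, ⟨pp, hpp, rfl⟩, rfl⟩
      exact ⟨pp.erase, List.mem_map_of_mem hpp, rfl⟩
    · rintro ⟨_, hpp, rfl⟩
      replace hpp := List.mem_map.1 hpp
      obtain ⟨pp, hpp, rfl⟩ := hpp
      exact ⟨_, ⟨pp, hpp, rfl⟩, rfl⟩
  | acceptNewView r V W b hr hready hbackup hnv hW henter =>
    refine .single ?_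
    have := Step.acceptNewView (svc := svc) (P := P) (m := .pbft) (byz := byz) (c.erase svc) r
      (eraseReports V) (W.map PrePrepare.erase) (b.erase svc) hr hready hbackup ⟨_, hnv, rfl⟩ (by
        intro pp hpp
        replace hpp := List.mem_map.1 hpp
        obtain ⟨pp, hpp, rfl⟩ := hpp
        exact ⟨_, hW pp hpp, rfl⟩) henter.erase
    rw [Config.erase_set]
    convert this using 2
    ext x
    constructor
    · rintro ⟨_, ⟨pp, hpp, rfl⟩, rfl⟩
      exact ⟨pp.erase, List.mem_map_of_mem hpp, rfl⟩
    · rintro ⟨_, hpp, rfl⟩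
      replace hpp := List.mem_map.1 hpp
      obtain ⟨pp, hpp, rfl⟩ := hpp
      exact ⟨_, ⟨pp, hpp, rfl⟩, rfl⟩

theorem Reachable.erase {c : Config N Tx Res St} (h : Reachable svc P Mode.lpbft byz c) :
    Reachable svc P Mode.pbft byz (c.erase svc) := by
  induction h with
  | refl =>
    have : (Config.start N svc).erase svc = Config.start N svc := by
      simp [Config.erase, Config.start, Replica.erase]
    exact Eq.subst (motive := Reachable svc P Mode.pbft byz) this.symm .refl
  | tail _ h ih => exact ih.trans h.erase

end Erase

/-! ### PBFT execution of committed batches. -/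

section Execution

variable {N : ℕ} [NeZero N] {Tx : Type u} {Res : Type v} {St : Type w}
  {svc : Service Tx Res St} {P : ℕ} {m : Mode} {byz : Finset (Fin N)}

/-- Finiteness bounds the committed sequence numbers, so that one PBFT run can serve all `n` at
once. -/
theorem Reachable.finite_net {c : Config N Tx Res St} (h : Reachable svc P m byz c) :
    c.net.Finite := by
  have hfin : ∀ (W : List (PrePrepare Tx Res)) (f : PrePrepare Tx Res → Msg N Tx Res),
      {x | ∃ pp ∈ W, x = f pp}.Finite := fun W f =>
    ((List.finite_toSet W).image f).subset (by rintro _ ⟨pp, hpp, rfl⟩; exact ⟨pp, hpp, rfl⟩)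
  induction h with
  | refl => exact Set.finite_empty
  | tail _ h ih =>
    cases h with
    | sendNewView r V W b => exact ih.union ((Set.finite_singleton _).union (hfin W _))
    | acceptNewView r V W b => exact ih.union (hfin W _)
    | _ => exact ih.union (Set.toFinite _)

theorem Committed.exists_commit {net : Set (Msg N Tx Res)} {pp : PrePrepare Tx Res}
    (h : Committed net pp) : ∃ r, Msg.commit r pp.view pp.seq ∈ net := by
  obtain ⟨Q, hQ, h⟩ := h
  -- With no replica excluded, this just says that a quorum is non-empty.
  obtain ⟨r, -, hr⟩ := exists_correct_mem (byz := ∅) (by simp) hQ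
  exact ⟨r, (h r hr).2⟩

/-- The sequence numbers of committed batches are bounded. -/
theorem Reachable.exists_seq_le {c : Config N Tx Res St} (h : Reachable svc P m byz c) :
    ∃ n, ∀ pp, Committed c.net pp → pp.seq ≤ n := by
  have hfin : {s | ∃ (r : Fin N) (v : ℕ), Msg.commit r v s ∈ c.net}.Finite := by
    refine (h.finite_net.image fun x => match x with
      | .commit _ _ s => s
      | _ => 0).subset ?_
    rintro s ⟨r, v, hs⟩
    exact ⟨_, hs, rfl⟩
  obtain ⟨n, hn⟩ := hfin.bddAbove
  refine ⟨n, fun pp hpp => ?_⟩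
  obtain ⟨r, hr⟩ := hpp.exists_commit
  exact hn ⟨r, _, hr⟩

theorem Store.ledger_exec_length (σ : Store Tx Res St) (B : List Tx) :
    (σ.exec svc B).ledger.length = σ.ledger.length + 1 := by
  simp [Store.ledger_exec]

/-- A correct replica can execute committed batches. -/
theorem Reachable.exists_execute {d : Config N Tx Res St} (h : Reachable svc P Mode.pbft byz d)
    {n : ℕ} (hn : ∀ s, 1 ≤ s → s ≤ n → ∃ pp, Committed d.net pp ∧ pp.seq = s) {r : Fin N}
    (hr : r ∉ byz) : ∃ d', Reachable svc P Mode.pbft byz d' ∧ d'.net = d.net ∧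
      n ≤ (d'.rep r).store.ledger.length ∧ ∀ q ≠ r, d'.rep q = d.rep q := by
  induction n with
  | zero => exact ⟨d, h, rfl, by simp, fun _ _ => rfl⟩
  | succ n ih =>
    obtain ⟨d', h₁, h₂, h₃, h₄⟩ := ih fun s hs hs' => hn s hs (by omega)
    -- A further execution is needed only if exactly `n` batches have been executed; otherwise the
    -- replica is already past `n`.
    rcases h₃.eq_or_lt with h₃ | h₃
    · obtain ⟨pp, hpp, hs⟩ := hn (n + 1) (by omega) le_rfl
      refine ⟨_, h₁.tail (Step.execCommitted d' r pp rfl hr (h₂ ▸ hpp) (by omega)), ?_, ?_, ?_⟩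
      · simp [Config.set, h₂]
      · simp [Config.set, Store.ledger_exec_length, ← h₃]
      · intro q hq
        simp [Config.set, hq, h₄ q hq]
    · exact ⟨d', h₁, h₂, h₃, h₄⟩

theorem Reachable.exists_executeAll {d : Config N Tx Res St}
    (h : Reachable svc P Mode.pbft byz d) {n : ℕ}
    (hn : ∀ s, 1 ≤ s → s ≤ n → ∃ pp, Committed d.net pp ∧ pp.seq = s) :
    ∃ d', Reachable svc P Mode.pbft byz d' ∧ d'.net = d.net ∧
      ∀ r, r ∉ byz → n ≤ (d'.rep r).store.ledger.length := by
  suffices ∀ S : Finset (Fin N), ∃ d', Reachable svc P Mode.pbft byz d' ∧ d'.net = d.net ∧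
      ∀ r ∈ S, r ∉ byz → n ≤ (d'.rep r).store.ledger.length by
    obtain ⟨d', h₁, h₂, h₃⟩ := this Finset.univ
    exact ⟨d', h₁, h₂, fun r => h₃ r (Finset.mem_univ r)⟩
  intro S
  induction S using Finset.induction_on with
  | empty => exact ⟨d, h, rfl, by simp⟩
  | insert r S hrS ih =>
    obtain ⟨d₁, h₁, h₂, h₃⟩ := ih
    by_cases hr : r ∈ byz
    · refine ⟨d₁, h₁, h₂, fun q hq hqb => ?_⟩
      rcases Finset.mem_insert.1 hq with rfl | hq
      · exact absurd hr hqb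
      · exact h₃ q hq hqb
    · obtain ⟨d₂, h₄, h₅, h₆, h₇⟩ := h₁.exists_execute (h₂ ▸ hn) hr
      refine ⟨d₂, h₄, h₅.trans h₂, fun q hq hqb => ?_⟩
      by_cases hqr : q = r
      · exact hqr ▸ h₆
      · rw [h₇ q hqr]
        exact h₃ q ((Finset.mem_insert.1 hq).resolve_left hqr) hqb

/-- The store of a replica consists of committed batches, executed in order. -/
def ExecutesCommitted (svc : Service Tx Res St) (net : Set (Msg N Tx Res))
    (σ : Store Tx Res St) : Prop :=
  ∃ Cs, σ = execAll svc Cs ∧ ∀ i B, Cs[i]? = some B →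
    ∃ q, Committed net q ∧ q.seq = i + 1 ∧ q.batch = B

theorem ExecutesCommitted.mono {net net' : Set (Msg N Tx Res)} (h : net ⊆ net')
    {σ : Store Tx Res St} (hσ : ExecutesCommitted svc net σ) : ExecutesCommitted svc net' σ := by
  obtain ⟨Cs, h₁, h₂⟩ := hσ
  exact ⟨Cs, h₁, fun i B hB => (h₂ i B hB).imp fun q hq => ⟨hq.1.mono h, hq.2⟩⟩

theorem executesCommitted_set {c : Config N Tx Res St}
    (hc : ∀ q, ExecutesCommitted svc c.net (c.rep q).store) {r : Fin N} {b : Replica Tx Res St}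
    {out : Set (Msg N Tx Res)} (hb : ExecutesCommitted svc c.net b.store) (q : Fin N) :
    ExecutesCommitted svc (c.set r b out).net ((c.set r b out).rep q).store := by
  have h : c.net ⊆ (c.set r b out).net := Set.subset_union_left
  by_cases hq : q = r
  · subst hq
    simpa [Config.set] using hb.mono h
  · simpa [Config.set, hq] using (hc q).mono h

theorem EnterView.store_eq {net : Set (Msg N Tx Res)} {v : ℕ}
    {V : Fin N → Option (List (PrePrepare Tx Res))} {W : List (PrePrepare Tx Res)}
    {a b : Replica Tx Res St} (h : EnterView svc P Mode.pbft net v V W a b) :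
    b.store = a.store := by
  obtain ⟨n, L, σ, τ, -, -, -, -, hσ, -, -, hτ, rfl⟩ := h
  change σ = a.store at hσ
  subst hσ
  generalize a.store = σ at hτ
  induction W with
  | nil => exact hτ
  | cons pp W ih =>
    obtain ⟨σ', ⟨-, rfl⟩, h⟩ := hτ
    exact ih h

/-- PBFT never rolls back, and its store changes only by executing a batch with commitment evidence
at the next position. -/
theorem Reachable.executesCommitted {d : Config N Tx Res St}
    (h : Reachable svc P Mode.pbft byz d) (r : Fin N) :
    ExecutesCommitted svc d.net (d.rep r).store := by
  induction h generalizing r with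
  | refl => exact ⟨[], rfl, by simp⟩
  | tail _ h ih =>
    cases h with
    | request t => exact (ih r).mono Set.subset_union_left
    | faulty r' x => exact (ih r).mono Set.subset_union_left
    | sendPrePrepare r' pp σ _ _ _ _ _ _ _ _ hexec =>
      exact executesCommitted_set ih (by rw [hexec.2]; exact ih r') r
    | acceptPrePrepare r' pp σ _ _ _ _ _ _ _ _ hexec =>
      exact executesCommitted_set ih (by rw [hexec.2]; exact ih r') r
    | rejectPrePrepare r' pp hm => cases hm
    | batchPrepared r' => exact executesCommitted_set ih (by exact ih r') r
    | execCommitted r' pp hm hr hcom hseq =>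
      refine executesCommitted_set ih ?_ r
      obtain ⟨Cs, h₁, h₂⟩ := ih r'
      rw [h₁, execAll_ledger_length] at hseq
      refine ⟨Cs ++ [pp.batch], by rw [execAll_concat, h₁], fun i B hB => ?_⟩
      rcases lt_or_ge i Cs.length with hlt | hge
      · exact h₂ i B (by rwa [List.getElem?_append_left hlt] at hB)
      · rw [List.getElem?_append_right hge, List.getElem?_singleton] at hB
        split_ifs at hB with hi
        exact ⟨pp, hcom, by omega, Option.some.inj hB⟩
    | sendViewChange r' => exact executesCommitted_set ih (by exact ih r') r
    | sendNewView r' V W b _ _ _ henter =>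
      exact executesCommitted_set ih (by rw [henter.store_eq]; exact ih r') r
    | acceptNewView r' V W b _ _ _ _ _ henter =>
      exact executesCommitted_set ih (by rw [henter.store_eq]; exact ih r') r

end Execution

/-! ### Comparison of ledgers and the main theorem. -/

theorem isPrefix_of_getElem?_eq {α : Type*} {As Bs : List α} (hlen : As.length ≤ Bs.length)
    (h : ∀ (i : ℕ) A B, As[i]? = some A → Bs[i]? = some B → A = B) : As <+: Bs := by
  rw [List.prefix_iff_getElem?]
  intro i hi
  have hi' : i < Bs.length := hi.trans_le hlen
  have h₁ := List.getElem?_eq_getElem hi'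
  rw [h₁, h i _ _ (List.getElem?_eq_getElem hi) h₁]

theorem exists_max_of_le {p : ℕ → Prop} {b : ℕ} (h₀ : p 0) (hb : ∀ k, p k → k ≤ b) :
    ∃ n, p n ∧ ∀ k, p k → k ≤ n := by
  classical
  exact ⟨Nat.findGreatest p b, Nat.findGreatest_spec (Nat.zero_le b) h₀,
    fun k hk => Nat.le_findGreatest (hb k hk) hk⟩

section Main

variable {N : ℕ} [NeZero N] {Tx : Type u} {Res : Type v} {St : Type w}
  {svc : Service Tx Res St} {P : ℕ} {byz : Finset (Fin N)} {c : Config N Tx Res St}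

/-- The batches up to a committed one, all of them (weakly) committed. -/
theorem Inv.exists_history (hbyz : byz.card ≤ faults N) (hc : Inv svc P Mode.lpbft byz c)
    {pp : PrePrepare Tx Res} (h : WeaklyCommitted byz c.net pp) :
    ∃ Bs : List (List Tx), pp.early = some (outcome svc Bs pp.batch) ∧ pp.seq = Bs.length + 1 ∧
      ∀ i B, (Bs ++ [pp.batch])[i]? = some B → ∃ q, WeaklyCommitted byz c.net q ∧
        q.seq = i + 1 ∧ q.view ≤ pp.view ∧ q.batch = B := by
  obtain ⟨Bs, h₁, h₂, h₃⟩ := hc.exists_outcome hbyz h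
  refine ⟨Bs, h₁, h₂, fun i B hB => ?_⟩
  rcases lt_or_ge i Bs.length with hlt | hge
  · exact h₃ i B (by rwa [List.getElem?_append_left hlt] at hB)
  · rw [List.getElem?_append_right hge, List.getElem?_singleton] at hB
    split_ifs at hB with hi
    exact ⟨pp, h, by omega, le_rfl, Option.some.inj hB⟩

/-- Executions of committed batches agree with batches committed in a run with early execution. -/
theorem ledger_comparable (hP : 1 ≤ P) (hbyz : byz.card ≤ faults N) {Bs : List (List Tx)}
    (hBs : ∀ i B, Bs[i]? = some B → ∃ q, WeaklyCommitted byz c.net q ∧ q.seq = i + 1 ∧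
      q.batch = B)
    {d : Config N Tx Res St} (hd : Reachable svc P Mode.pbft byz d)
    (hnet : Msg.erase '' c.net ⊆ d.net) (r : Fin N) :
    (d.rep r).store.ledger <+: (execAll svc Bs).ledger ∨
      (execAll svc Bs).ledger <+: (d.rep r).store.ledger := by
  obtain ⟨Cs, hσ, hCs⟩ := hd.executesCommitted r
  have heq : ∀ (i : ℕ) B C, Bs[i]? = some B → Cs[i]? = some C → B = C := by
    intro i B C hB hC
    obtain ⟨q, h₁, h₂, rfl⟩ := hBs i B hB
    obtain ⟨q', h₁', h₂', rfl⟩ := hCs i C hC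
    -- Agreement is applied inside the PBFT run `d`, where both batches are weakly committed.
    have := (hd.inv hbyz).batch_eq hP hbyz h₁'.weaklyCommitted (h₁.erase hnet)
      (h₂.trans h₂'.symm)
    exact this
  rw [hσ]
  rcases le_total Cs.length Bs.length with hle | hle
  · exact Or.inl (execAll_ledger_prefix svc
      (isPrefix_of_getElem?_eq hle fun i C B hC hB => (heq i B C hB hC).symm))
  · exact Or.inr (execAll_ledger_prefix svc (isPrefix_of_getElem?_eq hle heq))

/-- Batches that are committed before the view of the ledger of a correct replica are a prefix of
this ledger. -/
theorem Inv.isPrefix_log (hP : 1 ≤ P) (hbyz : byz.card ≤ faults N)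
    (hc : Inv svc P Mode.lpbft byz c) {r : Fin N} (hr : r ∉ byz) {v : ℕ}
    {log : List (PrePrepare Tx Res)} (hlog : LogOK svc P Mode.lpbft c.net r v log)
    {Bs : List (List Tx)} (hBs : ∀ i B, Bs[i]? = some B → ∃ q, WeaklyCommitted byz c.net q ∧
      q.seq = i + 1 ∧ q.view < v ∧ q.batch = B) : Bs <+: log.map PrePrepare.batch := by
  have key : ∀ (i : ℕ) B, Bs[i]? = some B → (log.map PrePrepare.batch)[i]? = some B := by
    intro i B hB
    obtain ⟨q, h₁, h₂, h₃, rfl⟩ := hBs i B hB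
    obtain ⟨q', hq', h₄, h₅⟩ := hc.persists hP hbyz v q h₁ h₃ r log hr hlog
    have h₆ := (hlog.getElem?_seq hq').2
    rw [h₄, h₂, Nat.add_sub_cancel] at h₆
    simp [h₆, h₅]
  exact List.prefix_iff_getElem?.2 fun i hi => key i _ (List.getElem?_eq_getElem hi)

end Main

end LPBFT

theorem mainTheorem5 {N : ℕ} [NeZero N] {Tx : Type u} {Res : Type v} {St : Type w}
    (svc : LPBFT.Service Tx Res St) (P : ℕ) (hP : 1 ≤ P)
    (byz : Finset (Fin N)) (hbyz : byz.card ≤ LPBFT.faults N)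
    (c : LPBFT.Config N Tx Res St) (hc : LPBFT.Reachable svc P LPBFT.Mode.lpbft byz c) :
    -- the same ordering messages occur in a PBFT run that has executed the committed batches
    (∃ d : LPBFT.Config N Tx Res St, LPBFT.Reachable svc P LPBFT.Mode.pbft byz d ∧
      d.net = LPBFT.Msg.erase '' c.net ∧
      ∀ n : ℕ, (∀ s, 1 ≤ s → s ≤ n → ∃ pp, LPBFT.Committed c.net pp ∧ pp.seq = s) →
        ∀ r, r ∉ byz → n ≤ (d.rep r).store.ledger.length) ∧
    ∀ pp, LPBFT.Committed c.net pp → ∃ L G, pp.early = some (L, G) ∧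
      pp.seq = L.length + 1 ∧ G.map Prod.fst = pp.batch ∧
      -- every PBFT execution of the same ordering messages agrees with the proposed results
      (∀ d : LPBFT.Config N Tx Res St, LPBFT.Reachable svc P LPBFT.Mode.pbft byz d →
        LPBFT.Msg.erase '' c.net ⊆ d.net → ∀ r, r ∉ byz →
          (d.rep r).store.ledger <+: L ++ [G] ∨ L ++ [G] <+: (d.rep r).store.ledger) ∧
      -- no roll-back loses or changes committed transactions
      (∀ r, r ∉ byz →
        (pp ∈ (c.rep r).log ∨ (pp.view < (c.rep r).view ∧ (c.rep r).ready = true)) →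
          L ++ [G] <+: (c.rep r).store.ledger) := by

  have hinv := hc.inv hbyz
  refine ⟨?_, fun pp hpp => ?_⟩
  · obtain ⟨b, hb⟩ := hc.exists_seq_le
    -- The same run `d` must work for every `n`, so the longest fully committed initial segment is
    -- taken.
    obtain ⟨n, hn, hmax⟩ := LPBFT.exists_max_of_le (b := b)
      (p := fun n => ∀ s, 1 ≤ s → s ≤ n → ∃ pp, LPBFT.Committed c.net pp ∧ pp.seq = s)
      (fun s h₁ h₂ => by omega) (fun k hk => by
        rcases Nat.eq_zero_or_pos k with rfl | hpos
        · exact Nat.zero_le b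
        · obtain ⟨pp, hpp, hs⟩ := hk k hpos le_rfl
          exact hs ▸ hb pp hpp)
    obtain ⟨d, hd, hnet, hlen⟩ := hc.erase.exists_executeAll (n := n) fun s h₁ h₂ => by
      obtain ⟨pp, hpp, hs⟩ := hn s h₁ h₂
      exact ⟨pp.erase, hpp.erase, hs⟩
    exact ⟨d, hd, hnet, fun k hk r hr => (hmax k hk).trans (hlen r hr)⟩
  · obtain ⟨Bs, hearly, hseq, hBs⟩ := hinv.exists_history hbyz (hpp.weaklyCommitted (byz := byz))
    have hledger := LPBFT.execAll_concat_ledger svc Bs pp.batch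
    refine ⟨_, _, hearly, ?_, LPBFT.Store.result_map_fst svc _ _, ?_, ?_⟩
    · rw [hseq, LPBFT.execAll_ledger_length]
    · intro d hd hnet r _
      refine Eq.subst (motive := fun l => _ <+: l ∨ l <+: _) hledger ?_
      exact LPBFT.ledger_comparable hP hbyz
        (fun i B hB => (hBs i B hB).imp fun q hq => ⟨hq.1, hq.2.1, hq.2.2.2⟩) hd hnet r
    · intro r hr hpos
      refine Eq.subst (motive := fun l => l <+: _) hledger ?_
      obtain ⟨lv, ha⟩ := hinv r hr
      rw [ha.store rfl]
      refine LPBFT.execAll_ledger_prefix svc ?_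
      -- The relevant view is that of the ledger, `lv`, which lags behind the replica's view during
      -- a view change.
      have hview : pp.view < lv ∨ (pp.view = lv ∧ pp ∈ (c.rep r).log) := by
        rcases hpos with hmem | ⟨hv, hready⟩
        · exact (ha.log_ok.view_le_of_mem hmem).lt_or_eq.imp_right fun h => ⟨h, hmem⟩
        · rcases ha.log_view with h | h
          · exact Or.inl (h.2 ▸ hv)
          · simp [hready] at h
      rcases hview with hlt | ⟨hv, hmem⟩
      · exact hinv.isPrefix_log hP hbyz hr ha.log_ok fun i B hB =>
          (hBs i B hB).imp fun q hq => ⟨hq.1, hq.2.1, hq.2.2.1.trans_lt hlt, hq.2.2.2⟩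
      · obtain ⟨h₁, hget⟩ := ha.log_ok.getElem?_seq hmem
        have he := ha.log_ok.early_eq hget hv
        -- The ledger of `r` and the history `Bs` both explain the outcome bound in `pp`, so `Bs`
        -- consists of the batches before `pp` in that ledger.
        rw [LPBFT.execAll_ledger_injective svc
          (congrArg Prod.fst (Option.some.inj (hearly.symm.trans he)))]
        obtain ⟨hi, hget⟩ := List.getElem?_eq_some_iff.1 hget
        have : (c.rep r).log.take (pp.seq - 1) ++ [pp] = (c.rep r).log.take (pp.seq - 1 + 1) := by
          rw [List.take_add_one, List.getElem?_eq_getElem hi, hget]; rfl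
        rw [← List.map_singleton, ← List.map_append, this]
        exact (List.take_prefix _ _).map _
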